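/- Setting. Let $N,M$ be nonzero unital C*-algebras with trivial centre (for instance the type III factors $N=A(O)$, $M=B(O)$ of a local extension $A\subset B$ of quantum field theories). For homomorphisms (unital *-homomorphisms) $\varphi_1,\varphi_2:A\to B$ put $\mathrm{Hom}(\varphi_1,\varphi_2)=\{t\in B: t\varphi_1(a)=\varphi_2(a)t\ \forall a\in A\}$; $\varphi$ is irreducible if $\mathrm{Hom}(\varphi,\varphi)=\mathbb C 1$. A normalized solution with parameter $d$ of the conjugacy relations for $\varphi:A\to B$, $\bar\varphi:B\to A$ is a pair $r\in\mathrm{Hom}(\mathrm{id}_A,\bar\varphi\varphi)$, $\bar r\in\mathrm{Hom}(\mathrm{id}_B,\varphi\bar\varphi)$ with $\varphi(r^*)\bar r=1$, $\bar\varphi(\bar r^*)r=1$, $r^*r=d\cdot 1$, $\bar r^*\bar r=d\cdot 1$; $\dim_\varphi$ is the infimum of $d$ over all $\bar\varphi$ and all such solutions, and a solution attaining it is called standard. Write $\varphi\simeq\bigoplus_k\varphi_k$ (finite sum) if there are isometries $t_k\in\mathrm{Hom}(\varphi_k,\varphi)$ with $\sum_k t_kt_k^*=1$. Let $\iota:N\to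 M$ be an irreducible homomorphism with conjugate $\bar\iota:M\to N$ and standard solution $w\in\mathrm{Hom}(\mathrm{id}_N,\theta)$, $v\in\mathrm{Hom}(\mathrm{id}_M,\gamma)$, where $\theta=\bar\iota\iota$, $\gamma=\iota\bar\iota$; put $x=\bar\iota(v)$. Suppose that $\theta$ belongs to a full tensor subcategory of $\mathrm{End}(N)$ with a unitary braiding $\varepsilon$, and that $\varepsilon_{\theta,\theta}\,x=x$ (the Q-system $(\theta,w,x)$ is commutative; for a local extension this holds with the DHR braiding of $A$). Let $\gamma\simeq\bigoplus_a\gamma_a$ with $\gamma_a$ irreducible, by means of isometries $s_a\in\mathrm{Hom}(\gamma_a,\gamma)$, $\sum_a s_as_a^*=1$. Put $h_a=(\dim_\iota/\dim_{\gamma_a})^{1/2}s_a^*\iota(w)$ and $\phi_a(\cdot)=h_a^*\gamma_a(\cdot)h_a:M\to M$. Let $\theta\simeq\bigoplus_n m_n\theta_n$ with $\theta_n$ irreducible and pairwise inequivalent, and let $\psi_{n,i}$ ($i=1,\dots,m_n$) be a basis of $\mathrm{Hom}(\iota,\iota\theta_n)$ with $\psi_{n,i}^*\psi_{n,j}=\delta_{ij}\cdot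 1$. Universal construction. Put $\Theta_{\rm uni}=\theta\theta$, $W_{\rm uni}=w\,w$ ($=w\times w$) and $X_{\rm uni}=\theta(\varepsilon_{\theta,\theta}^*)\,x\,\theta(x)$ (the braided product, with respect to $\varepsilon^-_{\rho,\sigma}=\varepsilon_{\sigma,\rho}^*$, of the Q-system with itself). Let $N\subset C_{\rm uni}$ be the extension defined by this Q-system, with embedding $\iota_{\rm uni}:N\to C_{\rm uni}$ and canonical generator $V_{\rm uni}$. It is realized, through the injective conjugate homomorphism $\bar\iota_{\rm uni}$, as the *-subalgebra of $N$ generated by $\Theta_{\rm uni}(N)$ and $X_{\rm uni}$, with $\iota_{\rm uni}=\Theta_{\rm uni}$ and $V_{\rm uni}=X_{\rm uni}$. Let $\jmath^L(m)=\iota_{\rm uni}(w^*\bar\iota(m))\,\iota_{\rm uni}(\theta(w^*))V_{\rm uni}$ and $\jmath^R(m)=\iota_{\rm uni}(w^*\bar\iota(m))\,\iota_{\rm uni}(w^*)V_{\rm uni}$ for $m\in M$. Finally put $e_a=s_as_a^*$, $I_a=\theta(w^*)\,\bar\iota(e_a)\,w\in\mathrm{Hom}(\theta,\theta)$, $q_a=w^*x^*\theta(I_a)\in\mathrm{Hom}(\theta\theta,\mathrm{id})$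 and $E_a=\iota_{\rm uni}(q_a)V_{\rm uni}\in C_{\rm uni}$. Claim. 1. $C_{\rm uni}=\iota_{\rm uni}(N)V_{\rm uni}$, and $\jmath^L,\jmath^R:M\to C_{\rm uni}$ are injective unital *-homomorphisms with $\jmath^L\iota=\jmath^R\iota=\iota_{\rm uni}$, $\jmath^L(v)=\iota_{\rm uni}(\theta(w^*))V_{\rm uni}$, $\jmath^R(v)=\iota_{\rm uni}(w^*)V_{\rm uni}$. 2. The $E_a$ are pairwise distinct, and they are precisely the minimal projections of the centre of $C_{\rm uni}$. 3. There are unique matrices $U_n(a)\in\mathrm{Mat}_{m_n}(\mathbb C)$ with $\phi_a(\psi_{n,i})=\sum_j\psi_{n,j}\,U_n(a)_{ji}$ (the representation matrices of the hypergroup formed by the maps $\phi_a$), and $$\jmath^L(\psi_{n,j}^*)\,\jmath^R(\psi_{n,i})=\sum_a U_n(a)_{ji}\,E_a\qquad\text{for all } n,i,j.$$ 4. For all $a$, $$E_a=\sum_{n,i}\frac{\dim_{\gamma_a}\dim_{\theta_n}}{(\dim_\iota)^2}\;\jmath^L(\phi_a(\psi_{n,i}^*))\,\jmath^R(\psi_{n,i}).$$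 5. For every representation (unital *-homomorphism into a unital complex *-algebra, for example $B(H)$) $\pi_a$ of $C_{\rm uni}$ with $\pi_a(E_b)=\delta_{ab}\cdot 1$ for all $b$, one has $$\pi_a(\jmath^L(\psi_{n,j}))^*\,\pi_a(\jmath^R(\psi_{n,i}))=U_n(a)_{ji}\cdot 1\qquad\text{for all } n,i,j.$$ -/

import Mathlib

noncomputable section

/-! ### Intertwiners, dimensions, direct sums -/

section Intertwiners

variable {A B : Type*} [CStarAlgebra A] [CStarAlgebra B]

/-- The intertwiner space `Hom(φ₁, φ₂) = {t ∈ B : t φ₁(a) = φ₂(a) t for all a ∈ A}` of two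
homomorphisms `φ₁ φ₂ : A → B`. -/
def Intertwiners (φ₁ φ₂ : A →⋆ₐ[ℂ] B) : Submodule ℂ B where
  carrier := {t | ∀ a, t * φ₁ a = φ₂ a * t}
  add_mem' := by
    intro s t hs ht a
    rw [add_mul, mul_add, hs a, ht a]
  zero_mem' := by
    intro a
    rw [zero_mul, mul_zero]
  smul_mem' := by
    intro c t ht a
    rw [smul_mul_assoc, mul_smul_comm, ht a]

/-- `φ` is irreducible: its self-intertwiners are the multiples of `1`. -/
def IsIrreducibleHom (φ : A →⋆ₐ[ℂ] B) : Prop :=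
  ∀ t ∈ Intertwiners φ φ, ∃ c : ℂ, t = c • (1 : B)

/-- Unitary equivalence of homomorphisms. -/
def UnitarilyEquivalent (φ₁ φ₂ : A →⋆ₐ[ℂ] B) : Prop :=
  ∃ u ∈ unitary B, u ∈ Intertwiners φ₁ φ₂

/-- `(r, r')` is a normalized solution, with parameter `d`, of the conjugacy relations between
`φ : A → B` and `φ' : B → A`:
`r ∈ Hom(id_A, φ'φ)`, `r' ∈ Hom(id_B, φφ')`, `(1_φ × r*) ∘ (r' × 1_φ) = 1`,
`(1_φ' × r'*) ∘ (r × 1_φ') = 1`, `r* r = d`, `r'* r' = d`. -/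
structure IsConjugateSolution (φ : A →⋆ₐ[ℂ] B) (φ' : B →⋆ₐ[ℂ] A) (r : A) (r' : B) (d : ℝ) :
    Prop where
  left_mem : r ∈ Intertwiners (StarAlgHom.id ℂ A) (φ'.comp φ)
  right_mem : r' ∈ Intertwiners (StarAlgHom.id ℂ B) (φ.comp φ')
  conj_left : φ (star r) * r' = 1
  conj_right : φ' (star r') * r = 1
  norm_left : star r * r = (d : ℂ) • (1 : A)
  norm_right : star r' * r' = (d : ℂ) • (1 : B)

/-- The dimension of `φ`: the infimum of the parameter `d` over all normalized solutions of the
conjugacy relations. -/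
def homDim (φ : A →⋆ₐ[ℂ] B) : ℝ :=
  sInf {d : ℝ | ∃ (φ' : B →⋆ₐ[ℂ] A) (r : A) (r' : B), IsConjugateSolution φ φ' r r' d}

/-- A standard solution of the conjugacy relations: one which attains the infimum. -/
def IsStandardSolution (φ : A →⋆ₐ[ℂ] B) (φ' : B →⋆ₐ[ℂ] A) (r : A) (r' : B) : Prop :=
  IsConjugateSolution φ φ' r r' (homDim φ)

/-- `φ` is the direct sum of the finitely many `φₖ`, by means of the isometries
`tₖ ∈ Hom(φₖ, φ)` with `∑ₖ tₖ tₖ* = 1` (so that `φ(·) = ∑ₖ tₖ φₖ(·) tₖ*`). -/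
structure IsDirectSumHom {κ : Type*} [Fintype κ] (φ : A →⋆ₐ[ℂ] B) (φs : κ → (A →⋆ₐ[ℂ] B))
    (t : κ → B) : Prop where
  mem : ∀ k, t k ∈ Intertwiners (φs k) φ
  isometry : ∀ k, star (t k) * t k = 1
  sum_eq_one : ∑ k, t k * star (t k) = 1

/-- `ψ` is a basis of `Hom(φ₁, φ₂)` consisting of isometries with mutually orthogonal ranges. -/
structure IsOrthonormalBasisOfIntertwiners {m : ℕ} (φ₁ φ₂ : A →⋆ₐ[ℂ] B) (ψ : Fin m → B) :
    Prop where
  mem : ∀ i, ψ i ∈ Intertwiners φ₁ φ₂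
  orthonormal : ∀ i j, star (ψ i) * ψ j = if i = j then 1 else 0
  span_eq : Submodule.span ℂ (Set.range ψ) = Intertwiners φ₁ φ₂

end Intertwiners

/-- A braided full tensor subcategory of the endomorphisms of `N`: a class of endomorphisms
containing the identity and closed under composition (the tensor product), together with
unitaries `ε ρ σ ∈ Hom(ρσ, σρ)` which are natural and satisfy the two hexagon identities
(the monoidal product of `t ∈ Hom(ρ, ρ')` and `s ∈ Hom(σ, σ')` is `t × s = t ρ(s)`). -/
structure BraidedEndos (N : Type*) [CStarAlgebra N] where
  obj : Set (N →⋆ₐ[ℂ] N)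
  id_mem : StarAlgHom.id ℂ N ∈ obj
  comp_mem : ∀ ρ ∈ obj, ∀ σ ∈ obj, ρ.comp σ ∈ obj
  ε : (N →⋆ₐ[ℂ] N) → (N →⋆ₐ[ℂ] N) → N
  ε_unitary : ∀ ρ ∈ obj, ∀ σ ∈ obj, ε ρ σ ∈ unitary N
  ε_mem : ∀ ρ ∈ obj, ∀ σ ∈ obj, ε ρ σ ∈ Intertwiners (ρ.comp σ) (σ.comp ρ)
  natural : ∀ ρ ∈ obj, ∀ ρ' ∈ obj, ∀ σ ∈ obj, ∀ σ' ∈ obj,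
    ∀ t ∈ Intertwiners ρ ρ', ∀ s ∈ Intertwiners σ σ',
      ε ρ' σ' * (t * ρ s) = (s * σ t) * ε ρ σ
  hexagon_left : ∀ ρ ∈ obj, ∀ σ ∈ obj, ∀ τ ∈ obj,
    ε (ρ.comp σ) τ = ε ρ τ * ρ (ε σ τ)
  hexagon_right : ∀ ρ ∈ obj, ∀ σ ∈ obj, ∀ τ ∈ obj,
    ε ρ (σ.comp τ) = σ (ε ρ τ) * ε ρ σ

/-- An irreducible extension `ι : N → M` of finite index with a conjugate homomorphism
`ι' : M → N`, a standard solution `(w, v)` of the conjugacy relations, and a braided category of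
endomorphisms of `N` which contains the dual canonical endomorphism `θ = ι' ι` and with respect to
which the Q-system `(θ, w, x)`, `x = ι'(v)`, is commutative. For a local extension `A ⊂ B` of
quantum field theories these are `N = A(O)`, `M = B(O)` and the DHR braiding of `A`. -/
structure LocalExtension (N M : Type*) [CStarAlgebra N] [CStarAlgebra M] where
  ι : N →⋆ₐ[ℂ] M
  ι' : M →⋆ₐ[ℂ] N
  w : N
  v : M
  standard : IsStandardSolution ι ι' w v
  irreducible : IsIrreducibleHom ι
  cat : BraidedEndos N
  theta_mem : ι'.comp ι ∈ cat.obj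
  commutative : cat.ε (ι'.comp ι) (ι'.comp ι) * ι' v = ι' v

namespace LocalExtension

variable {N M : Type*} [CStarAlgebra N] [CStarAlgebra M] (S : LocalExtension N M)

/-- The dual canonical endomorphism `θ = ι' ι` of `N`. -/
def θ : N →⋆ₐ[ℂ] N := S.ι'.comp S.ι

/-- The canonical endomorphism `γ = ι ι'` of `M`. -/
def γ : M →⋆ₐ[ℂ] M := S.ι.comp S.ι'

/-- The coproduct `x = ι'(v) ∈ Hom(θ, θ²)` of the Q-system `(θ, w, x)`. -/
def x : N := S.ι' S.v

/-! ### The positive maps `φₐ` -/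

/-- The isometry `hₐ = (dim ι / dim γₐ)^{1/2} sₐ* ι(w)`, where `sₐ ∈ Hom(γₐ, γ)`. -/
def h (γa : M →⋆ₐ[ℂ] M) (sa : M) : M :=
  ((Real.sqrt (homDim S.ι / homDim γa) : ℝ) : ℂ) • (star sa * S.ι S.w)

/-- The positive map `φₐ(m) = hₐ* γₐ(m) hₐ` of `M`. -/
def posMap (γa : M →⋆ₐ[ℂ] M) (sa : M) (m : M) : M :=
  star (S.h γa sa) * γa m * S.h γa sa

/-! ### The universal construction -/

/-- `Θ_uni = θ θ`. -/
def Θuni : N →⋆ₐ[ℂ] N := S.θ.comp S.θ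

/-- `X_uni = (1_θ × ε⁻_{θ,θ} × 1_θ) ∘ (x × x)`, the coproduct of the braided product of the
Q-system with itself, where `ε⁻_{ρ,σ} = ε_{σ,ρ}*`. -/
def Xuni : N := S.θ (star (S.cat.ε S.θ S.θ)) * (S.x * S.θ S.x)

/-- The extension `C_uni` of `N` given by the braided product Q-system `(Θ_uni, W_uni, X_uni)`,
`W_uni = w × w`. The embedding `ι'_uni : C_uni → N` satisfies `ι'_uni ι_uni = Θ_uni` and
`ι'_uni(V_uni) = X_uni`, and it is used to realize `C_uni` as the subalgebra of `N` which is
generated by `Θ_uni(N)` and `X_uni`; so `ι'_uni` is the coercion `C_uni → N`. -/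
def Cuni : StarSubalgebra ℂ N :=
  StarAlgebra.adjoin ℂ (Set.range S.Θuni ∪ {S.Xuni})

/-- The embedding `ι_uni : N → C_uni`. -/
def ιuni : N →⋆ₐ[ℂ] S.Cuni :=
  S.Θuni.codRestrict S.Cuni
    (fun n => StarAlgebra.subset_adjoin ℂ _ (Or.inl (Set.mem_range_self n)))

/-- The canonical generator `V_uni` of `C_uni`. -/
def Vuni : S.Cuni :=
  ⟨S.Xuni, StarAlgebra.subset_adjoin ℂ _ (Or.inr (Set.mem_singleton _))⟩

/-- The image `ι_uni(1_θ × w*) V_uni` of the canonical generator `v` under `jᴸ`. -/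
def vL : S.Cuni := S.ιuni (S.θ (star S.w)) * S.Vuni

/-- The image `ι_uni(w* × 1_θ) V_uni` of the canonical generator `v` under `jᴿ`. -/
def vR : S.Cuni := S.ιuni (star S.w) * S.Vuni

/-- The left embedding `jᴸ : M → C_uni`, determined by `jᴸ ι = ι_uni`, by `jᴸ(v)`, and by
`m = ι(w* ι'(m)) v`. -/
def jL (m : M) : S.Cuni := S.ιuni (star S.w * S.ι' m) * S.vL

/-- The right embedding `jᴿ : M → C_uni`, determined by `jᴿ ι = ι_uni`, by `jᴿ(v)`, and by
`m = ι(w* ι'(m)) v`. -/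
def jR (m : M) : S.Cuni := S.ιuni (star S.w * S.ι' m) * S.vR

/-! ### The central projections -/

/-- The Fourier transform
`χ(t) = (v* × 1_γ) ∘ (1_ι × t × 1_ι') ∘ (1_γ × v)` from `Hom(θ, θ)` to `Hom(γ, γ)`. -/
def fourier (t : N) : M := star S.v * S.ι t * S.γ S.v

/-- Its inverse `χ⁻¹(e) = (1_θ × w*) ∘ (1_ι' × e × 1_ι) ∘ (w × 1_θ)`. -/
def fourierInv (e : M) : N := S.θ (star S.w) * S.ι' e * S.w

/-- The Frobenius map `q ↦ (1_θ × q) ∘ (x w × 1_θ)` from `Hom(θθ, id)` to `Hom(θ, θ)`. -/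
def frob (q : N) : N := S.θ q * (S.x * S.w)

/-- Its inverse `I ↦ w* ∘ x* ∘ (1_θ × I)`. -/
def frobInv (I : N) : N := star S.w * star S.x * S.θ I

theorem fourier_fourierInv (e : M) (he : e ∈ Intertwiners S.γ S.γ) :
    S.fourier (S.fourierInv e) = e := by
  have h2 : star S.v * S.ι S.w = 1 := by
    simpa [← map_star] using congrArg star S.standard.conj_left
  have h3 : star S.w * S.ι' S.v = 1 := by
    simpa [← map_star] using congrArg star S.standard.conj_right
  have h4 : ∀ m, star S.v * S.ι (S.ι' m) = m * star S.v := by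
    intro m
    have h : S.v * star m = S.ι (S.ι' (star m)) * S.v := S.standard.right_mem (star m)
    simpa [← map_star] using (congrArg star h).symm
  have h5 : ∀ m, e * S.ι (S.ι' m) = S.ι (S.ι' m) * e := he
  change star S.v * S.ι (S.ι' (S.ι (star S.w)) * S.ι' e * S.w) * S.ι (S.ι' S.v) = e
  calc star S.v * S.ι (S.ι' (S.ι (star S.w)) * S.ι' e * S.w) * S.ι (S.ι' S.v)
      = star S.v * S.ι (S.ι' (S.ι (star S.w) * e)) * S.ι S.w * S.ι (S.ι' S.v) := by
        simp only [map_mul, mul_assoc]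
    _ = S.ι (star S.w) * e * (star S.v * S.ι S.w) * S.ι (S.ι' S.v) := by
        rw [h4]; simp only [mul_assoc]
    _ = S.ι (star S.w * S.ι' S.v) * e := by
        rw [h2, mul_one, mul_assoc, h5, map_mul, mul_assoc]
    _ = e := by rw [h3, map_one, one_mul]

theorem frob_frobInv (I : N) :
    S.frob (S.frobInv I) = I := by
  have h1 : S.ι (star S.w) * S.v = 1 := S.standard.conj_left
  have h2 : S.ι' (star S.v) * S.w = 1 := S.standard.conj_right
  have hv : ∀ m, S.v * m = S.ι (S.ι' m) * S.v := S.standard.right_mem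
  have hw : ∀ n, S.w * n = S.ι' (S.ι n) * S.w := S.standard.left_mem
  have hx : star (S.ι' S.v) = S.ι' (star S.v) := (map_star S.ι' S.v).symm
  change S.ι' (S.ι (star S.w * star (S.ι' S.v) * S.ι' (S.ι I))) * (S.ι' S.v * S.w) = I
  rw [hx]
  calc S.ι' (S.ι (star S.w * S.ι' (star S.v) * S.ι' (S.ι I))) * (S.ι' S.v * S.w)
      = S.ι' (S.ι (star S.w) * S.ι (S.ι' (star S.v)) * (S.ι (S.ι' (S.ι I)) * S.v)) * S.w := by
        simp only [map_mul, mul_assoc]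
    _ = S.ι' (S.ι (star S.w) * (S.ι (S.ι' (star S.v)) * S.v) * S.ι I) * S.w := by
        rw [← hv]; simp only [mul_assoc]
    _ = S.ι' (S.ι (star S.w) * S.v * (star S.v * S.ι I)) * S.w := by
        rw [← hv]; simp only [mul_assoc]
    _ = S.ι' (star S.v) * (S.ι' (S.ι I) * S.w) := by
        rw [h1, one_mul, map_mul, mul_assoc]
    _ = I := by rw [← hw, ← mul_assoc, h2, one_mul]

/-- The element `E = ι_uni(q) V_uni` of `C_uni` with `q = frobInv I`, `I = fourierInv e`, and
`e = s s*` the projection onto the range of an isometry `s ∈ Hom(γₐ, γ)`. -/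
def E (sa : M) : S.Cuni :=
  S.ιuni (S.frobInv (S.fourierInv (sa * star sa))) * S.Vuni

end LocalExtension

/-- Minimal projections of the center of a *-algebra. -/
structure IsMinimalCentralProjection {C : Type*} [Ring C] [StarRing C] (p : C) : Prop where
  projection : IsStarProjection p
  central : p ∈ Set.center C
  ne_zero : p ≠ 0
  minimal : ∀ q : C, IsStarProjection q → q ∈ Set.center C → q * p = q → q = 0 ∨ q = p

end

noncomputable section

/-! ### Preliminaries on C*-algebras -/

section Preliminaries

variable {A : Type*} [CStarAlgebra A]

/-! `M` sits in `N` twice with the same restriction θθ to `N`: through m ↦ θ(ι'(m)), which is jᴿ,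
and through its conjugate by the braiding ε = ε_{θ,θ}, which is jᴸ. Naturality of ε at x and the
hexagons give jᴸ(v) = θ(ε*)x. Hence X_uni = jᴸ(v)jᴿ(v), and jᴿ(v)jᴸ(v) = θθ(ε*)X_uni. So the
elements θθ(n)X_uni already form a *-algebra, and multiplying twice by w* recovers n.

An element θθ(q)X_uni commutes with the image of `N` exactly when q ∈ Hom(θθ, id). Pulling q through
the braiding and absorbing ε by εx = x turns the element into ι'(f) with f ∈ Hom(γ, γ)
(`Θuni_mul_Xuni_eq`), and shows that it also commutes with jᴸ(v) and jᴿ(v) (`commute_of_mem_Cuni`).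
So the relative commutant of `N` is the centre and equals ι'(Hom(γ, γ)). In particular Hom(γ, γ) is
abelian, its minimal projections are the e_a = s_a s_a*, and E_a = ι'(e_a).

The products jᴸ(ψ_j*)jᴿ(ψ_i) commute with `N`, hence are combinations of the E_a. Closing a strand
with w identifies the coefficients as ψ_j*φ_a(ψ_i) (`mul_proj_eq_smul_of_posMap`), provided that
ι(w*)e_a ι(w) = dim γ_a / dim ι.

This normalization is the hard part (`trace_eq_homDim`), because the dimension is defined as an
infimum. For irreducible homomorphisms all normalized solutions share one parameter, so it suffices
to exhibit a solution for γ_a. Its conjugate is found inside γ as the range of the rotated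
projection. Positivity of the trace forces the rotation to be an involution. The same result for θ
gives the completeness relation `sum_sum_smul_eq_one`, which collapses the weighted sum to E_a. -/

theorem smul_one_injective [Nontrivial A] {c c' : ℂ} (h : c • (1 : A) = c' • (1 : A)) : c = c' := by
  have h2 : (c - c') • (1 : A) = 0 := by rw [sub_smul, h, sub_self]
  rcases smul_eq_zero.mp h2 with h3 | h3
  · exact sub_eq_zero.mp h3
  · exact absurd h3 one_ne_zero

/-- The scalar is real because a*a is selfadjoint, nonnegative because it is the spectrum of a*a,
and the C*-identity gives its modulus. -/
theorem eq_norm_sq_of_star_mul_self_eq_smul_one [Nontrivial A] {a : A} {c : ℂ}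
    (h : star a * a = c • (1 : A)) : c = ((‖a‖ ^ 2 : ℝ) : ℂ) := by
  have hsa : star c = c := by
    refine smul_one_injective (A := A) ?_
    have h2 := congrArg star h
    rw [star_mul, star_star, h, star_smul, star_one] at h2
    exact h2.symm
  have hre : c = ((c.re : ℝ) : ℂ) := (Complex.conj_eq_iff_re.mp hsa).symm
  have hc : 0 ≤ c.re := by
    refine spectrum_star_mul_self_nonneg (b := a) _ ?_
    have h3 : star a * a = algebraMap ℝ A c.re := by
      rw [h, Algebra.algebraMap_eq_smul_one]
      conv_lhs => rw [hre]
      exact Complex.coe_smul _ _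
    rw [h3, spectrum.scalar_eq]
    rfl
  have hn : ‖a‖ ^ 2 = c.re := by
    rw [sq, ← CStarRing.norm_star_mul_self, h, norm_smul, norm_one, mul_one, hre]
    simpa using hc
  rw [hn]
  exact hre

theorem eq_zero_of_sum_star_mul_self_eq_zero {κ : Type*} {s : Finset κ} {f : κ → A}
    (h : ∑ k ∈ s, star (f k) * f k = 0) : ∀ k ∈ s, f k = 0 := by
  -- In the spectral order each summand is positive, so a vanishing sum forces every summand to
  -- vanish.
  let := CStarAlgebra.spectralOrder A
  have := CStarAlgebra.spectralOrderedRing A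
  have h2 := (Finset.sum_eq_zero_iff_of_nonneg (fun k _ => star_mul_self_nonneg (f k))).mp h
  exact fun k hk => (CStarRing.star_mul_self_eq_zero_iff _).mp (h2 k hk)

theorem eq_zero_of_star_mul_self_add_eq_zero {a b : A} (h : star a * a + star b * b = 0) :
    a = 0 := by
  refine eq_zero_of_sum_star_mul_self_eq_zero (s := Finset.univ) (f := ![a, b]) ?_ 0
    (Finset.mem_univ _)
  simpa [Fin.sum_univ_two] using h

theorem exists_smul_one_of_forall_commute [Algebra.IsCentral ℂ A] {z : A}
    (h : ∀ a, z * a = a * z) : ∃ c : ℂ, z = c • (1 : A) := by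
  have hz : z ∈ Subalgebra.center ℂ A :=
    Subalgebra.mem_center_iff.mpr fun a => (h a).symm
  obtain ⟨c, hc⟩ := Algebra.mem_bot.mp (Algebra.IsCentral.out (K := ℂ) (D := A) hz)
  exact ⟨c, by rw [← hc, Algebra.algebraMap_eq_smul_one]⟩

end Preliminaries

/-! ### Intertwiners -/

section IntertwinerCalculus

variable {A B : Type*} [CStarAlgebra A] [CStarAlgebra B] {φ₁ φ₂ φ₃ : A →⋆ₐ[ℂ] B}

theorem Intertwiners.star_mem {t : B} (ht : t ∈ Intertwiners φ₁ φ₂) :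
    star t ∈ Intertwiners φ₂ φ₁ := by
  intro a
  have h := congrArg star (ht (star a))
  simpa [← map_star] using h.symm

theorem Intertwiners.mul_mem {s t : B} (hs : s ∈ Intertwiners φ₂ φ₃)
    (ht : t ∈ Intertwiners φ₁ φ₂) : s * t ∈ Intertwiners φ₁ φ₃ := by
  intro a
  rw [mul_assoc, ht a, ← mul_assoc, hs a, mul_assoc]

/-- The isometries of a direct sum have mutually orthogonal ranges. -/
theorem IsDirectSumHom.star_mul_eq_zero {κ : Type*} [Fintype κ] {φ : A →⋆ₐ[ℂ] B}
    {φs : κ → (A →⋆ₐ[ℂ] B)} {t : κ → B} (ht : IsDirectSumHom φ φs t) {a b : κ} (hab : a ≠ b) :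
    star (t a) * t b = 0 := by
  classical
  -- Sandwiching 1 = ∑ t_k t_k* between t_b* and t_b leaves 1 = 1 + ∑_{k≠b} (t_k*t_b)*(t_k*t_b).
  have h1 : star (t b) * (∑ k, t k * star (t k)) * t b = 1 := by
    rw [ht.sum_eq_one, mul_one, ht.isometry]
  rw [← Finset.add_sum_erase _ _ (Finset.mem_univ b), mul_add, add_mul, ← mul_assoc, ht.isometry,
    one_mul, ht.isometry, Finset.mul_sum, Finset.sum_mul, add_eq_left] at h1
  refine eq_zero_of_sum_star_mul_self_eq_zero (s := Finset.univ.erase b)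
    (f := fun k => star (t k) * t b) ?_ a (Finset.mem_erase.mpr ⟨hab, Finset.mem_univ _⟩)
  rw [← h1]
  refine Finset.sum_congr rfl fun k _ => ?_
  rw [star_mul, star_star]
  simp only [mul_assoc]

end IntertwinerCalculus

/-! ### Solutions of the conjugacy relations -/

namespace IsConjugateSolution

variable {A B : Type*} [CStarAlgebra A] [CStarAlgebra B] {φ : A →⋆ₐ[ℂ] B} {φ' : B →⋆ₐ[ℂ] A}
  {r : A} {r' : B} {d : ℝ}

theorem symm (h : IsConjugateSolution φ φ' r r' d) : IsConjugateSolution φ' φ r' r d :=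
  ⟨h.right_mem, h.left_mem, h.conj_right, h.conj_left, h.norm_right, h.norm_left⟩

variable (h : IsConjugateSolution φ φ' r r' d)
include h

theorem left_mul (a : A) : r * a = φ' (φ a) * r := h.left_mem a

theorem star_left_mul (a : A) : star r * φ' (φ a) = a * star r :=
  Intertwiners.star_mem h.left_mem a

theorem right_mul (b : B) : r' * b = φ (φ' b) * r' := h.right_mem b

theorem star_right_mul (b : B) : star r' * φ (φ' b) = b * star r' :=
  Intertwiners.star_mem h.right_mem b

theorem star_conj_left : star r' * φ r = 1 := by
  simpa [← map_star] using congrArg star h.conj_left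

theorem star_conj_right : star r * φ' r' = 1 := by
  simpa [← map_star] using congrArg star h.conj_right

theorem param_pos [Nontrivial A] : 0 < d := by
  have h1 := eq_norm_sq_of_star_mul_self_eq_smul_one h.norm_left
  have h2 : d = ‖r‖ ^ 2 := by exact_mod_cast h1
  have hr : r ≠ 0 := by
    rintro rfl
    have h3 := h.conj_right
    rw [mul_zero] at h3
    exact zero_ne_one h3
  rw [h2]
  have : 0 < ‖r‖ := norm_pos_iff.mpr hr
  positivity

theorem injective : Function.Injective φ := by
  intro a b hab
  have h1 : ∀ a, a = φ' (star r') * (φ' (φ a) * r) := fun a => by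
    rw [← h.left_mul, ← mul_assoc, h.conj_right, one_mul]
  rw [h1 a, h1 b, hab]

/-- The Frobenius transpose φ(r*z)r' of z lies in Hom(φ, φ), hence is a scalar, and the zigzag
relations carry this back to z. -/
theorem irreducible_symm (hφ : IsIrreducibleHom φ) : IsIrreducibleHom φ' := by
  intro z hz
  obtain ⟨c, hc⟩ := hφ (φ (star r * z) * r') (by
    intro a
    rw [mul_assoc, h.right_mul, ← mul_assoc, ← mul_assoc, ← map_mul, ← map_mul, mul_assoc (star r),
      hz, ← mul_assoc, h.star_left_mul, mul_assoc])
  refine ⟨c, ?_⟩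
  have h1 : φ (z - c • 1) * r' = 0 := by
    have h2 : φ z * r' = φ (star r * z) * r' * r' := by
      rw [mul_assoc, h.right_mul, ← mul_assoc, ← map_mul, mul_assoc (star r), hz, ← mul_assoc,
        h.star_conj_right, one_mul]
    rw [map_sub, map_smul, map_one, sub_mul, h2, hc, sub_self]
  have h3 : star r * φ' (φ (z - c • 1) * r') = z - c • 1 := by
    rw [map_mul, ← mul_assoc, h.star_left_mul, mul_assoc, h.star_conj_right, mul_one]
  rw [h1, map_zero, mul_zero] at h3
  exact (sub_eq_zero.mp h3.symm)

/-- All the normalized solutions for an irreducible homomorphism have the same parameter. -/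
theorem param_eq [Nontrivial A] (hφ : IsIrreducibleHom φ) {φ'' : B →⋆ₐ[ℂ] A} {s : A} {s' : B}
    {d' : ℝ} (k : IsConjugateSolution φ φ'' s s' d') : d = d' := by
  -- The canonical comparison of the two conjugates: u ∈ Hom(φ'', φ') carries s to r, and φ(u*)
  -- carries r' to s'.
  set u := φ' (star s') * r with hu
  have hmem : u ∈ Intertwiners φ'' φ' := by
    intro b
    rw [hu, mul_assoc, h.left_mul, ← mul_assoc, ← map_mul, k.star_right_mul, map_mul, mul_assoc]
  have hus : u * s = r := by
    rw [hu, mul_assoc, h.left_mul, ← mul_assoc, ← map_mul, k.star_conj_left, map_one, one_mul]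
  have hus' : φ (star u) * r' = s' := by
    rw [hu, star_mul, ← map_star, star_star, map_mul, mul_assoc, ← h.right_mul, ← mul_assoc,
      h.conj_left, one_mul]
  obtain ⟨l, hl⟩ := k.irreducible_symm hφ _ (Intertwiners.mul_mem (Intertwiners.star_mem hmem) hmem)
  obtain ⟨m, hm⟩ := h.irreducible_symm hφ _ (Intertwiners.mul_mem hmem (Intertwiners.star_mem hmem))
  have hu0 : u ≠ 0 := by
    rintro h0
    have h1 := h.norm_left
    rw [← hus, h0, zero_mul, mul_zero] at h1
    have h2 := h.param_pos
    have h3 : ((d : ℂ)) = 0 := smul_one_injective (A := A) (by rw [← h1, zero_smul])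
    exact h2.ne' (by exact_mod_cast h3)
  have hlm : l = m := by
    have h1 : l • u = m • u := by
      rw [← mul_one (l • u), smul_mul_assoc, ← mul_smul_comm, ← hl, ← mul_assoc, hm,
        smul_mul_assoc, one_mul]
    have h2 : (l - m) • u = 0 := by rw [sub_smul, h1, sub_self]
    exact sub_eq_zero.mp ((smul_eq_zero.mp h2).resolve_right hu0)
  have hl2 := eq_norm_sq_of_star_mul_self_eq_smul_one hl
  -- u*u and uu* are the same scalar ‖u‖². Comparing r with s gives d = ‖u‖²d', comparing r' with s'
  -- gives d' = ‖u‖²d; positivity then leaves only d = d'.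
  have h1 : (d : ℂ) = l * d' := by
    refine smul_one_injective (A := A) ?_
    rw [← h.norm_left, ← hus, star_mul, mul_assoc, ← mul_assoc (star u), hl, smul_mul_assoc,
      one_mul, mul_smul_comm, k.norm_left, smul_smul]
  have h2 : (d' : ℂ) • (1 : B) = (m * d) • 1 := by
    rw [← k.norm_right, ← hus', star_mul, ← map_star, star_star, mul_assoc, ← mul_assoc (φ u),
      ← map_mul, hm, map_smul, map_one, smul_mul_assoc, one_mul, mul_smul_comm, h.norm_right,
      smul_smul]
  have : Nontrivial B := h.injective.nontrivial
  have h3 := smul_one_injective h2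
  rw [← hlm, hl2] at h3
  rw [hl2] at h1
  have h4 : d = ‖u‖ ^ 2 * d' := by exact_mod_cast h1
  have h5 : d' = ‖u‖ ^ 2 * d := by exact_mod_cast h3
  have h6 := h.param_pos
  have h7 := k.param_pos
  nlinarith [sq_nonneg ‖u‖]

theorem homDim_eq [Nontrivial A] (hφ : IsIrreducibleHom φ) : homDim φ = d := by
  have h1 : {d : ℝ | ∃ (φ' : B →⋆ₐ[ℂ] A) (r : A) (r' : B), IsConjugateSolution φ φ' r r' d} = {d} := by
    ext d'
    constructor
    · rintro ⟨φ'', s, s', k⟩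
      exact (h.param_eq hφ k).symm
    · rintro rfl
      exact ⟨φ', r, r', h⟩
  rw [homDim, h1, csInf_singleton]

end IsConjugateSolution

/-! ### Self-conjugate endomorphisms -/

/-- `R` is a spherical solution of the conjugacy relations of `Γ` with itself. -/
structure IsSphericalSelfConjugate {B : Type*} [CStarAlgebra B] (Γ : B →⋆ₐ[ℂ] B) (R : B) :
    Prop where
  mem : R ∈ Intertwiners (StarAlgHom.id ℂ B) (Γ.comp Γ)
  conj : Γ (star R) * R = 1
  spherical : ∀ a ∈ Intertwiners Γ Γ, star R * a * R = star R * Γ a * R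

/-- The quarter turn of `a ∈ Hom(Γ, Γ)`. -/
def rot {B : Type*} [CStarAlgebra B] (Γ : B →⋆ₐ[ℂ] B) (R a : B) : B :=
  Γ (star R * a) * R

namespace IsSphericalSelfConjugate

variable {B : Type*} [CStarAlgebra B] {Γ : B →⋆ₐ[ℂ] B} {R : B}
  (h : IsSphericalSelfConjugate Γ R)
include h

theorem mul_eq (b : B) : R * b = Γ (Γ b) * R := h.mem b

theorem star_mul_eq (b : B) : star R * Γ (Γ b) = b * star R :=
  Intertwiners.star_mem h.mem b

theorem star_conj : star R * Γ R = 1 := by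
  simpa [← map_star] using congrArg star h.conj

theorem rot_mem {a : B} (ha : a ∈ Intertwiners Γ Γ) : rot Γ R a ∈ Intertwiners Γ Γ := by
  intro b
  rw [rot, mul_assoc, h.mul_eq, ← mul_assoc, ← map_mul, mul_assoc (star R), ha, ← mul_assoc,
    h.star_mul_eq, map_mul, map_mul, map_mul]
  simp only [mul_assoc]

/-- Characterizes the rotation: an endomorphism on the second leg of R may be moved to the first
leg. By `ext`, this identity determines `rot`. -/
theorem rot_mul {a : B} (ha : a ∈ Intertwiners Γ Γ) : rot Γ R a * R = Γ a * R := by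
  rw [rot, mul_assoc, h.mul_eq, ← mul_assoc, ← map_mul, mul_assoc (star R), ha, ← mul_assoc,
    h.star_conj, one_mul]

theorem ext {a b : B} (ha : a ∈ Intertwiners Γ Γ) (hb : b ∈ Intertwiners Γ Γ)
    (hab : a * R = b * R) : a = b := by
  have h1 : ∀ c ∈ Intertwiners Γ Γ, c = Γ (star R) * (c * R) := fun c hc => by
    rw [← mul_assoc, ← hc, mul_assoc, h.conj, mul_one]
  rw [h1 a ha, h1 b hb, hab]

/-- Two elements carried around the cup R arrive in the opposite order. -/
theorem rot_mul_rev {a b : B} (ha : a ∈ Intertwiners Γ Γ) (hb : b ∈ Intertwiners Γ Γ) :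
    rot Γ R (a * b) = rot Γ R b * rot Γ R a := by
  have hra := h.rot_mem ha
  have hrb := h.rot_mem hb
  refine h.ext (h.rot_mem (Intertwiners.mul_mem ha hb)) (Intertwiners.mul_mem hrb hra) ?_
  rw [h.rot_mul (Intertwiners.mul_mem ha hb), mul_assoc, h.rot_mul ha, ← mul_assoc, hrb,
    mul_assoc, h.rot_mul hb, map_mul, mul_assoc]

theorem trace_rot {a : B} (ha : a ∈ Intertwiners Γ Γ) :
    star R * rot Γ R a * R = star R * a * R := by
  rw [mul_assoc, h.rot_mul ha, h.spherical a ha, mul_assoc]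

theorem rot_star_rot {a : B} (ha : a ∈ Intertwiners Γ Γ) :
    rot Γ R (star (rot Γ R a)) = star a := by
  have h1 : star R * star (rot Γ R a) = star R * Γ (star a) := by
    rw [← star_mul, h.rot_mul ha, star_mul, map_star]
  rw [rot, h1, map_mul, mul_assoc, ← h.mul_eq, ← mul_assoc, h.conj, one_mul]

/-- The trace a ↦ R*aR is cyclic up to the twist rot²; once `rot_rot` is known, the twist
disappears. -/
theorem trace_mul_eq_rot {a b : B} (ha : a ∈ Intertwiners Γ Γ) (hb : b ∈ Intertwiners Γ Γ) :
    star R * (a * b) * R = star R * (b * rot Γ R (rot Γ R a)) * R := by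
  have hra := h.rot_mem ha
  have h1 : star R * Γ (rot Γ R a) = star R * a := by
    have h2 := h.rot_mul (Intertwiners.star_mem hra)
    rw [h.rot_star_rot ha] at h2
    simpa [← map_star] using (congrArg star h2).symm
  rw [mul_assoc (star R) (b * _), mul_assoc b, h.rot_mul hra, ← mul_assoc b, hb, mul_assoc (Γ _),
    ← mul_assoc (star R) _ (b * R), h1]
  simp only [mul_assoc]

/-- Twisted cyclicity is used twice, with invariance of the trace under the antimultiplicative
rotation in between. -/
theorem trace_mul_eq_rot_four {a b : B} (ha : a ∈ Intertwiners Γ Γ) (hb : b ∈ Intertwiners Γ Γ) :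
    star R * (a * rot Γ R (rot Γ R (rot Γ R (rot Γ R b)))) * R = star R * (a * b) * R := by
  have hb2 := h.rot_mem (h.rot_mem hb)
  rw [← h.trace_mul_eq_rot hb2 ha, ← h.trace_rot (Intertwiners.mul_mem hb2 ha),
    h.rot_mul_rev hb2 ha, ← h.trace_mul_eq_rot (h.rot_mem hb) (h.rot_mem ha),
    ← h.rot_mul_rev ha hb, h.trace_rot (Intertwiners.mul_mem ha hb)]

theorem eq_zero_of_mul_eq_zero {a : B} (ha : a ∈ Intertwiners Γ Γ) (h0 : a * R = 0) : a = 0 :=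
  h.ext ha (Submodule.zero_mem _) (by rw [h0, zero_mul])

omit h in
theorem rot_sub (a b : B) : rot Γ R (a - b) = rot Γ R a - rot Γ R b := by
  rw [rot, mul_sub, map_sub, sub_mul, rot, rot]

/-- For y = rot⁴(a) − a the previous identity makes the trace of y*y vanish, and the trace is
faithful. -/
theorem rot_four {a : B} (ha : a ∈ Intertwiners Γ Γ) :
    rot Γ R (rot Γ R (rot Γ R (rot Γ R a))) = a := by
  have h4 := h.rot_mem (h.rot_mem (h.rot_mem (h.rot_mem ha)))
  set y := rot Γ R (rot Γ R (rot Γ R (rot Γ R a))) - a with hy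
  have hym : y ∈ Intertwiners Γ Γ := Submodule.sub_mem _ h4 ha
  have h1 : star (y * R) * (y * R) = 0 := by
    rw [star_mul, mul_assoc, ← mul_assoc (star y), ← mul_assoc]
    conv_lhs => rw [hy, mul_sub, mul_sub, sub_mul, ← hy,
      h.trace_mul_eq_rot_four (Intertwiners.star_mem hym) ha, sub_self]
  exact sub_eq_zero.mp
    (h.eq_zero_of_mul_eq_zero hym ((CStarRing.star_mul_self_eq_zero_iff _).mp h1))

/-- For y = rot²(a) − a, `rot_four` gives rot²(y) = −y. Twisted cyclicity then makes the traces of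
yy* and y*y opposite; both are positive, so y = 0. -/
theorem rot_rot {a : B} (ha : a ∈ Intertwiners Γ Γ) : rot Γ R (rot Γ R a) = a := by
  have h2 := h.rot_mem (h.rot_mem ha)
  set y := rot Γ R (rot Γ R a) - a with hy
  have hym : y ∈ Intertwiners Γ Γ := Submodule.sub_mem _ h2 ha
  have hry : rot Γ R (rot Γ R y) = -y := by
    rw [hy, rot_sub, rot_sub, h.rot_four ha, neg_sub]
  have h1 := h.trace_mul_eq_rot hym (Intertwiners.star_mem hym)
  rw [hry] at h1
  refine sub_eq_zero.mp (h.eq_zero_of_mul_eq_zero hym ?_)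
  refine eq_zero_of_star_mul_self_add_eq_zero (b := star y * R) ?_
  rw [star_mul, star_mul, star_star]
  simp only [mul_neg, neg_mul, mul_assoc] at h1 ⊢
  rw [h1, add_neg_cancel]

theorem trace_mul_comm {a b : B} (ha : a ∈ Intertwiners Γ Γ) (hb : b ∈ Intertwiners Γ Γ) :
    star R * (a * b) * R = star R * (b * a) * R := by
  rw [h.trace_mul_eq_rot ha hb, h.rot_rot ha]

theorem rot_star {a : B} (ha : a ∈ Intertwiners Γ Γ) : rot Γ R (star a) = star (rot Γ R a) := by
  rw [← h.rot_star_rot ha, h.rot_rot (Intertwiners.star_mem (h.rot_mem ha))]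

theorem exists_trace_eq_smul [Algebra.IsCentral ℂ B] {a : B} (ha : a ∈ Intertwiners Γ Γ) :
    ∃ c : ℂ, star R * a * R = c • (1 : B) := by
  refine exists_smul_one_of_forall_commute fun b => ?_
  rw [mul_assoc, h.mul_eq, ← mul_assoc, mul_assoc (star R), ha, ← mul_assoc, h.star_mul_eq]
  simp only [mul_assoc]

/-- The zigzag relation for `star s' * Γ (star s) * R` and `star s * Γ (star s') * R`, when the
ranges of `s` and `s'` are conjugate subobjects of `Γ`. -/
theorem zigzag_of_isometry {σ : B →⋆ₐ[ℂ] B} {s s' : B}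
    (hs : s ∈ Intertwiners σ Γ) (hs1 : star s * s = 1)
    (he : Γ (s' * star s') * R = s * star s * R) :
    σ (star (star s' * Γ (star s) * R)) * (star s * Γ (star s') * R) = 1 := by
  have hs' : ∀ b, σ b * star s = star s * Γ b := fun b => (Intertwiners.star_mem hs b).symm
  calc σ (star (star s' * Γ (star s) * R)) * (star s * Γ (star s') * R)
      = star s * Γ (star R * Γ s * s') * Γ (star s') * R := by
        rw [← mul_assoc, ← mul_assoc, hs']
        simp only [star_mul, star_star, ← map_star, mul_assoc]
    _ = star s * Γ (star R * Γ s) * (Γ (s' * star s') * R) := by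
        simp only [map_mul, mul_assoc]
    _ = star s * (Γ (star R * Γ s) * s) * (star s * R) := by
        rw [he]; simp only [mul_assoc]
    _ = star s * Γ (star R) * (Γ (Γ s) * (s * star s)) * R := by
        simp only [map_mul, mul_assoc]
    _ = star s * Γ (star R) * ((s * star s) * Γ (Γ s)) * R := by
        rw [Intertwiners.mul_mem hs (Intertwiners.star_mem hs)]
    _ = star s * (Γ (star R) * (s * star s)) * (R * s) := by
        rw [h.mul_eq]; simp only [mul_assoc]
    _ = star s * s * (star s * (Γ (star R) * R)) * s := by
        rw [← Intertwiners.mul_mem hs (Intertwiners.star_mem hs)]; simp only [mul_assoc]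
    _ = 1 := by rw [h.conj, hs1, one_mul, mul_one, hs1]

/-- The dimension of an irreducible subobject of `Γ` is the trace of its support projection. -/
theorem trace_eq_homDim [Nontrivial B] [Algebra.IsCentral ℂ B] {σ : B →⋆ₐ[ℂ] B} {s : B}
    (hσ : IsIrreducibleHom σ) (hs : s ∈ Intertwiners σ Γ) (hs1 : star s * s = 1)
    {κ : Type*} [Fintype κ] {σs : κ → (B →⋆ₐ[ℂ] B)} {t : κ → B}
    (hσs : ∀ k, IsIrreducibleHom (σs k)) (ht : IsDirectSumHom Γ σs t) :
    0 < homDim σ ∧ star R * (s * star s) * R = (homDim σ : ℂ) • (1 : B) := by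
  have hss := Intertwiners.star_mem hs
  have he := Intertwiners.mul_mem hs hss
  set e := s * star s with hedef
  have hee : e * e = e := by
    rw [hedef, mul_assoc, ← mul_assoc (star s), hs1, one_mul]
  have hestar : star e = e := by rw [hedef, star_mul, star_star]
  -- The range of the rotated projection will carry the conjugate of σ.
  set f := rot Γ R e with hf
  have hfm : f ∈ Intertwiners Γ Γ := h.rot_mem he
  have hrf : rot Γ R f = e := h.rot_rot he
  have hff : f * f = f := by rw [hf, ← h.rot_mul_rev he he, hee]
  have hfstar : star f = f := by rw [hf, ← h.rot_star he, hestar]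
  have hf0 : f ≠ 0 := by
    intro h0
    have h1 : e = 0 := by rw [← hrf, h0, rot, mul_zero, map_zero, zero_mul]
    have h2 : star s * e * s = 0 := by rw [h1, mul_zero, zero_mul]
    rw [hedef, ← mul_assoc, hs1, one_mul, hs1] at h2
    exact one_ne_zero h2
  obtain ⟨k, hk⟩ : ∃ k, f * t k ≠ 0 := by
    by_contra! h0
    refine hf0 ?_
    rw [← mul_one f, ← ht.sum_eq_one, Finset.mul_sum]
    refine Finset.sum_eq_zero fun k _ => ?_
    rw [← mul_assoc, h0 k, zero_mul]
  set y := f * t k with hy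
  have hym : y ∈ Intertwiners (σs k) Γ := Intertwiners.mul_mem hfm (ht.mem k)
  obtain ⟨c, hc⟩ := hσs k _ (Intertwiners.mul_mem (Intertwiners.star_mem hym) hym)
  have hc2 := eq_norm_sq_of_star_mul_self_eq_smul_one hc
  -- Irreducibility of the summand makes y*y a scalar, so rescaling y gives an isometry with range
  -- inside that of f.
  set s' := ((‖y‖⁻¹ : ℝ) : ℂ) • y with hs'
  have hny : ‖y‖ ≠ 0 := norm_ne_zero_iff.mpr hk
  have hs'm : s' ∈ Intertwiners (σs k) Γ := Submodule.smul_mem _ _ hym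
  have hs'1 : star s' * s' = 1 := by
    rw [hs', star_smul, smul_mul_assoc, mul_smul_comm, hc, hc2, smul_smul, smul_smul]
    simp only [Complex.star_def, Complex.conj_ofReal]
    rw [← Complex.ofReal_mul, ← Complex.ofReal_mul]
    have h9 : ‖y‖⁻¹ * ‖y‖⁻¹ * ‖y‖ ^ 2 = 1 := by field_simp
    rw [h9, Complex.ofReal_one, one_smul]
  have hfs' : f * s' = s' := by
    rw [hs', mul_smul_comm, hy, ← mul_assoc, hff]
  have hgm := Intertwiners.mul_mem hs'm (Intertwiners.star_mem hs'm)
  -- The rotation maps g ≤ f into the corner e Hom(Γ, Γ) e, which is one-dimensional as σ is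
  -- irreducible. So g is a multiple of f, and the factor is 1.
  have hg : s' * star s' = f := by
    set g := s' * star s' with hg
    have hfg : f * g = g := by rw [hg, ← mul_assoc, hfs']
    have hgf : g * f = g := by
      have h1 := congrArg star hfg
      rwa [star_mul, hfstar, hg, star_mul, star_star] at h1
    have hz : e * rot Γ R g * e = rot Γ R g := by
      rw [← hrf, ← h.rot_mul_rev hgm hfm, hgf, ← h.rot_mul_rev hfm hgm, hfg]
    obtain ⟨c', hc'⟩ := hσ _ (Intertwiners.mul_mem (Intertwiners.mul_mem hss (h.rot_mem hgm)) hs)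
    have hze : rot Γ R g = c' • e := by
      rw [← hz, hedef]
      calc s * star s * rot Γ R g * (s * star s) = s * (star s * rot Γ R g * s) * star s := by
            simp only [mul_assoc]
        _ = c' • (s * star s) := by rw [hc', mul_smul_comm, mul_one, smul_mul_assoc]
    have hgc : g = c' • f := by
      rw [← h.rot_rot hgm, hze, hf, rot, rot, mul_smul_comm, map_smul, smul_mul_assoc]
    have h1 : c' • s' = s' := by
      calc c' • s' = c' • f * s' := by rw [smul_mul_assoc, hfs']
        _ = s' := by rw [← hgc, hg, mul_assoc, hs'1, mul_one]
    have h2 : c' = 1 := by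
      refine smul_one_injective (A := B) ?_
      rw [← hs'1, ← mul_smul_comm, h1, one_smul]
    rw [hgc, h2, one_smul]
  obtain ⟨l, hl⟩ := h.exists_trace_eq_smul he
  have hl2 : star (e * R) * (e * R) = l • (1 : B) := by
    rw [← hl, star_mul, hestar, ← mul_assoc, mul_assoc (star R), hee]
  have hl3 := eq_norm_sq_of_star_mul_self_eq_smul_one hl2
  have hmem : ∀ {ρ τ : B →⋆ₐ[ℂ] B} {a b : B}, a ∈ Intertwiners ρ Γ → b ∈ Intertwiners τ Γ →
      star b * Γ (star a) * R ∈ Intertwiners (StarAlgHom.id ℂ B) (τ.comp ρ) := by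
    intro ρ τ a b ha hb n
    have ha' := Intertwiners.star_mem ha n
    have hb' := Intertwiners.star_mem hb (ρ n)
    change star b * Γ (star a) * R * n = τ (ρ n) * (star b * Γ (star a) * R)
    rw [mul_assoc, h.mul_eq, ← mul_assoc, mul_assoc (star b), ← map_mul, ha', map_mul, ← mul_assoc,
      hb']
    simp only [mul_assoc]
  have hnorm : ∀ {a b p q : B}, p ∈ Intertwiners Γ Γ → a * star a = q → b * star b = p →
      Γ q * R = p * R → p * p = p → star (star b * Γ (star a) * R) * (star b * Γ (star a) * R)
        = star R * p * R := by
    intro a b p q hp ha hb hpq hpp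
    calc star (star b * Γ (star a) * R) * (star b * Γ (star a) * R)
        = star R * (Γ a * (b * star b)) * Γ (star a) * R := by
          simp only [star_mul, star_star, ← map_star, mul_assoc]
      _ = star R * p * (Γ (a * star a) * R) := by
          rw [hb, ← hp, map_mul]; simp only [mul_assoc]
      _ = star R * p * R := by rw [ha, hpq, ← mul_assoc, mul_assoc (star R), hpp]
  have hef : Γ e * R = f * R := (h.rot_mul he).symm
  have hfe : Γ f * R = e * R := by rw [← h.rot_mul hfm, hrf]
  -- Compressing R to the ranges of e and f gives the solution; its two parameters are the traces of
  -- f and e, equal by `trace_rot`.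
  have hsol : IsConjugateSolution σ (σs k) (star s' * Γ (star s) * R) (star s * Γ (star s') * R)
      (‖e * R‖ ^ 2) := by
    refine ⟨hmem hs hs'm, hmem hs'm hs, h.zigzag_of_isometry hs hs1 ?_,
      h.zigzag_of_isometry hs'm hs'1 ?_, ?_, ?_⟩
    · rw [hg, hfe]
    · rw [hg, hef]
    · rw [hnorm hfm rfl hg hef hff, ← hl3, ← hl, h.trace_rot he]
    · rw [hnorm he hg rfl hfe hee, ← hl3, ← hl]
  rw [hsol.homDim_eq hσ]
  exact ⟨hsol.param_pos, by rw [hl, hl3]⟩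

end IsSphericalSelfConjugate

/-! ### Partial traces for an irreducible homomorphism -/

namespace IsConjugateSolution

variable {A B : Type*} [CStarAlgebra A] [CStarAlgebra B] {φ : A →⋆ₐ[ℂ] B} {φ' : B →⋆ₐ[ℂ] A}
  {r : A} {r' : B} {d : ℝ} (h : IsConjugateSolution φ φ' r r' d)
include h

theorem exists_partial_traces [Nontrivial A] (hφ : IsIrreducibleHom φ) {a : B}
    (ha : a ∈ Intertwiners (φ.comp φ') (φ.comp φ')) :
    ∃ c : ℂ, φ (star r) * a * φ r = c • (1 : B) ∧ star r * φ' a * r = c • (1 : A) := by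
  obtain ⟨l, hl⟩ := h.irreducible_symm hφ (star r * φ' a * r) (by
    intro b
    have hab : φ' a * φ' (φ (φ' b)) = φ' (φ (φ' b)) * φ' a := by
      rw [← map_mul, ← map_mul]; exact congrArg φ' (ha b)
    rw [mul_assoc, h.left_mul, ← mul_assoc, mul_assoc (star r), hab, ← mul_assoc, h.star_left_mul]
    simp only [mul_assoc])
  obtain ⟨m, hm⟩ := hφ (φ (star r) * a * φ r) (by
    intro n
    have hab : a * φ (φ' (φ n)) = φ (φ' (φ n)) * a := ha (φ n)
    rw [mul_assoc, ← map_mul, h.left_mul, map_mul, ← mul_assoc, mul_assoc (φ (star r)), hab,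
      ← mul_assoc, ← map_mul, h.star_left_mul, map_mul]
    simp only [mul_assoc])
  -- Closing the remaining strand in either order yields the same full trace, so the two scalars
  -- agree.
  have hlm : m = l := by
    have h1 : m • (star r * r) = l • (star r * r) := by
      calc m • (star r * r) = star r * φ' (m • (1 : B)) * r := by
            rw [map_smul, map_one, mul_smul_comm, mul_one, smul_mul_assoc]
        _ = star r * φ' (φ (star r)) * φ' a * (φ' (φ r) * r) := by
            rw [← hm]; simp only [map_mul, mul_assoc]
        _ = star r * (star r * φ' a * r) * r := by
            rw [h.star_left_mul, ← h.left_mul]; simp only [mul_assoc]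
        _ = l • (star r * r) := by
            rw [hl, mul_smul_comm, mul_one, smul_mul_assoc]
    rw [h.norm_left, smul_smul, smul_smul] at h1
    have hd : (d : ℂ) ≠ 0 := by exact_mod_cast h.param_pos.ne'
    exact mul_right_cancel₀ hd (smul_one_injective h1)
  exact ⟨l, by rw [hm, hlm], hl⟩

/-- R consists of two nested cups. Each side of sphericality is a partial trace closed by r', and
the two partial traces are the same scalar. -/
theorem isSphericalSelfConjugate [Nontrivial A] (hφ : IsIrreducibleHom φ) :
    IsSphericalSelfConjugate (φ.comp φ') (φ r * r') where
  mem := by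
    intro b
    change φ r * r' * b = φ (φ' (φ (φ' b))) * (φ r * r')
    rw [mul_assoc, h.right_mul, ← mul_assoc, ← map_mul, h.left_mul, map_mul, mul_assoc]
  conj := by
    change φ (φ' (star (φ r * r'))) * (φ r * r') = 1
    rw [star_mul, map_mul, ← mul_assoc, ← map_mul, ← map_star, mul_assoc, ← h.left_mul,
      ← mul_assoc, h.conj_right, one_mul, h.conj_left]
  spherical := by
    intro a ha
    obtain ⟨c, hc1, hc2⟩ := h.exists_partial_traces hφ ha
    change star (φ r * r') * a * (φ r * r') = star (φ r * r') * φ (φ' a) * (φ r * r')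
    calc star (φ r * r') * a * (φ r * r') = star r' * (φ (star r) * a * φ r) * r' := by
          rw [star_mul, map_star]; simp only [mul_assoc]
      _ = star r' * φ (star r * φ' a * r) * r' := by rw [hc1, hc2, map_smul, map_one]
      _ = star (φ r * r') * φ (φ' a) * (φ r * r') := by
          rw [star_mul, map_mul, map_mul, map_star]; simp only [mul_assoc]

theorem partial_trace_isometry [Nontrivial A] [Nontrivial B] [Algebra.IsCentral ℂ B]
    (hφ : IsIrreducibleHom φ) {σ : B →⋆ₐ[ℂ] B} {s : B}
    (hσ : IsIrreducibleHom σ) (hs : s ∈ Intertwiners σ (φ.comp φ')) (hs1 : star s * s = 1)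
    {κ : Type*} [Fintype κ] {σs : κ → (B →⋆ₐ[ℂ] B)} {t : κ → B}
    (hσs : ∀ k, IsIrreducibleHom (σs k)) (ht : IsDirectSumHom (φ.comp φ') σs t) :
    0 < homDim σ ∧ φ (star r) * (s * star s) * φ r = ((homDim σ / d : ℝ) : ℂ) • (1 : B) ∧
      star r * φ' (s * star s) * r = ((homDim σ / d : ℝ) : ℂ) • (1 : A) := by
  obtain ⟨hpos, htr⟩ := (h.isSphericalSelfConjugate hφ).trace_eq_homDim hσ hs hs1 hσs ht
  obtain ⟨c, hc1, hc2⟩ :=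
    h.exists_partial_traces hφ (Intertwiners.mul_mem hs (Intertwiners.star_mem hs))
  have hc : c = ((homDim σ / d : ℝ) : ℂ) := by
    have h1 : star (φ r * r') * (s * star s) * (φ r * r') = (c * d) • (1 : B) := by
      calc star (φ r * r') * (s * star s) * (φ r * r')
          = star r' * (φ (star r) * (s * star s) * φ r) * r' := by
            rw [star_mul, map_star]; simp only [mul_assoc]
        _ = (c * d) • (1 : B) := by
            rw [hc1, mul_smul_comm, mul_one, smul_mul_assoc, h.norm_right, smul_smul]
    have h2 := smul_one_injective (h1.symm.trans htr)
    have hd : (d : ℂ) ≠ 0 := by exact_mod_cast h.param_pos.ne'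
    rw [Complex.ofReal_div, ← h2, mul_div_cancel_right₀ _ hd]
  exact ⟨hpos, hc ▸ hc1, hc ▸ hc2⟩

/-- The partial trace is a scalar, so only the full trace matters; traciality moves ss* across st*,
where t*s = 0 kills it. -/
theorem partial_trace_orthogonal [Nontrivial A] [Nontrivial B]
    (hφ : IsIrreducibleHom φ) {σ : B →⋆ₐ[ℂ] B} {s t : B}
    (hs : s ∈ Intertwiners σ (φ.comp φ')) (ht : t ∈ Intertwiners σ (φ.comp φ'))
    (hs1 : star s * s = 1) (hst : star t * s = 0) :
    star r * φ' (s * star t) * r = 0 := by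
  have hS := h.isSphericalSelfConjugate hφ
  have hm := Intertwiners.mul_mem hs (Intertwiners.star_mem ht)
  obtain ⟨c, hc1, hc2⟩ := h.exists_partial_traces hφ hm
  have h0 : star (φ r * r') * (s * star t) * (φ r * r') = 0 := by
    have h1 := hS.trace_mul_comm (Intertwiners.mul_mem hs (Intertwiners.star_mem hs)) hm
    have h2 : s * star s * (s * star t) = s * star t := by
      rw [mul_assoc, ← mul_assoc (star s), hs1, one_mul]
    have h3 : s * star t * (s * star s) = 0 := by
      rw [mul_assoc, ← mul_assoc (star t), hst, zero_mul, mul_zero]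
    rw [h2, h3, mul_zero, zero_mul] at h1
    exact h1
  have h1 : star (φ r * r') * (s * star t) * (φ r * r') = (c * d) • (1 : B) := by
    calc star (φ r * r') * (s * star t) * (φ r * r')
        = star r' * (φ (star r) * (s * star t) * φ r) * r' := by
          rw [star_mul, map_star]; simp only [mul_assoc]
      _ = (c * d) • (1 : B) := by
          rw [hc1, mul_smul_comm, mul_one, smul_mul_assoc, h.norm_right, smul_smul]
  have hd : (d : ℂ) ≠ 0 := by exact_mod_cast h.param_pos.ne'
  have h2 : c * d = 0 := smul_one_injective (A := B) (by rw [← h1, h0, zero_smul])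
  rw [hc2, (mul_eq_zero.mp h2).resolve_right hd, zero_smul]

end IsConjugateSolution

theorem Intertwiners.one_mem {A B : Type*} [CStarAlgebra A] [CStarAlgebra B] (φ : A →⋆ₐ[ℂ] B) :
    (1 : B) ∈ Intertwiners φ φ := fun a => by rw [one_mul, mul_one]

/-! ### Consequences of the braiding axioms -/

namespace BraidedEndos

variable {N : Type*} [CStarAlgebra N] (𝒞 : BraidedEndos N)

/-- The hexagon makes this unitary idempotent. -/
theorem ε_id_right {ρ : N →⋆ₐ[ℂ] N} (hρ : ρ ∈ 𝒞.obj) : 𝒞.ε ρ (StarAlgHom.id ℂ N) = 1 := by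
  have h1 := 𝒞.hexagon_right ρ hρ _ 𝒞.id_mem _ 𝒞.id_mem
  have h2 := (Unitary.mem_iff.mp (𝒞.ε_unitary ρ hρ _ 𝒞.id_mem)).1
  change 𝒞.ε ρ (StarAlgHom.id ℂ N) = 𝒞.ε ρ (StarAlgHom.id ℂ N) * 𝒞.ε ρ (StarAlgHom.id ℂ N) at h1
  have h3 := congrArg (star (𝒞.ε ρ (StarAlgHom.id ℂ N)) * ·) h1
  simp only [← mul_assoc, h2, one_mul] at h3
  exact h3.symm

theorem ε_id_left {ρ : N →⋆ₐ[ℂ] N} (hρ : ρ ∈ 𝒞.obj) : 𝒞.ε (StarAlgHom.id ℂ N) ρ = 1 := by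
  have h1 := 𝒞.hexagon_left _ 𝒞.id_mem _ 𝒞.id_mem ρ hρ
  have h2 := (Unitary.mem_iff.mp (𝒞.ε_unitary _ 𝒞.id_mem ρ hρ)).1
  change 𝒞.ε (StarAlgHom.id ℂ N) ρ = 𝒞.ε (StarAlgHom.id ℂ N) ρ * 𝒞.ε (StarAlgHom.id ℂ N) ρ at h1
  have h3 := congrArg (star (𝒞.ε (StarAlgHom.id ℂ N) ρ) * ·) h1
  simp only [← mul_assoc, h2, one_mul] at h3
  exact h3.symm

theorem natural_right {ρ σ σ' : N →⋆ₐ[ℂ] N} (hρ : ρ ∈ 𝒞.obj) (hσ : σ ∈ 𝒞.obj)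
    (hσ' : σ' ∈ 𝒞.obj) {s : N} (hs : s ∈ Intertwiners σ σ') :
    𝒞.ε ρ σ' * ρ s = s * 𝒞.ε ρ σ := by
  simpa using 𝒞.natural ρ hρ ρ hρ σ hσ σ' hσ' 1 (Intertwiners.one_mem ρ) s hs

theorem natural_left {ρ ρ' σ : N →⋆ₐ[ℂ] N} (hρ : ρ ∈ 𝒞.obj) (hρ' : ρ' ∈ 𝒞.obj)
    (hσ : σ ∈ 𝒞.obj) {t : N} (ht : t ∈ Intertwiners ρ ρ') :
    𝒞.ε ρ' σ * t = σ t * 𝒞.ε ρ σ := by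
  simpa using 𝒞.natural ρ hρ ρ' hρ' σ hσ σ hσ t ht 1 (Intertwiners.one_mem σ)

end BraidedEndos

/-! ### Relations of the commutative Q-system and the braiding -/

namespace LocalExtension

variable {N M : Type*} [CStarAlgebra N] [CStarAlgebra M] (S : LocalExtension N M)

theorem sol : IsConjugateSolution S.ι S.ι' S.w S.v (homDim S.ι) := S.standard

theorem θ_mem_obj : S.θ ∈ S.cat.obj := S.theta_mem

theorem θθ_mem_obj : S.θ.comp S.θ ∈ S.cat.obj := S.cat.comp_mem _ S.theta_mem _ S.theta_mem

/-- The braiding `ε_{θ,θ}`. -/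
def braid : N := S.cat.ε S.θ S.θ

theorem star_braid_mul_braid : star S.braid * S.braid = 1 :=
  (Unitary.mem_iff.mp (S.cat.ε_unitary _ S.theta_mem _ S.theta_mem)).1

theorem braid_mul_star_braid : S.braid * star S.braid = 1 :=
  (Unitary.mem_iff.mp (S.cat.ε_unitary _ S.theta_mem _ S.theta_mem)).2

theorem braid_mul (n : N) : S.braid * S.θ (S.θ n) = S.θ (S.θ n) * S.braid :=
  S.cat.ε_mem _ S.theta_mem _ S.theta_mem n

theorem braid_mul_x : S.braid * S.x = S.x := S.commutative

theorem w_mul (n : N) : S.w * n = S.θ n * S.w := S.sol.left_mul n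

theorem x_mul (n : N) : S.x * S.θ n = S.θ (S.θ n) * S.x := by
  change S.ι' S.v * S.ι' (S.ι n) = S.ι' (S.ι (S.ι' (S.ι n))) * S.ι' S.v
  rw [← map_mul, S.sol.right_mul, map_mul]

theorem star_w_mul_x : star S.w * S.x = 1 := S.sol.star_conj_right

theorem θ_star_w_mul_x : S.θ (star S.w) * S.x = 1 := by
  change S.ι' (S.ι (star S.w)) * S.ι' S.v = 1
  rw [← map_mul, S.sol.conj_left, map_one]

theorem x_mem : S.x ∈ Intertwiners S.θ (S.θ.comp S.θ) := S.x_mul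

theorem θ_braid_mul_braid_mul_θ_x : S.θ S.braid * S.braid * S.θ S.x = S.x * S.braid := by
  have h := S.cat.natural_right S.θ_mem_obj S.θ_mem_obj S.θθ_mem_obj S.x_mem
  rwa [S.cat.hexagon_right _ S.θ_mem_obj _ S.θ_mem_obj _ S.θ_mem_obj] at h

theorem braid_mul_θ_braid_mul_x : S.braid * S.θ S.braid * S.x = S.θ S.x * S.braid := by
  have h := S.cat.natural_left S.θ_mem_obj S.θθ_mem_obj S.θ_mem_obj S.x_mem
  rwa [S.cat.hexagon_left _ S.θ_mem_obj _ S.θ_mem_obj _ S.θ_mem_obj] at h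

/-- The pair θθ crosses a θ strand and is then annihilated by q; braiding with the identity is
trivial. The companion below has q in the other argument of ε, and the two serve jᴿ and jᴸ
respectively. -/
theorem θ_eq_mul_of_mem {q : N} (hq : q ∈ Intertwiners (S.θ.comp S.θ) (StarAlgHom.id ℂ N)) :
    S.θ q = q * S.θ S.braid * S.braid := by
  have h := S.cat.natural_right S.θ_mem_obj S.θθ_mem_obj S.cat.id_mem hq
  rw [S.cat.hexagon_right _ S.θ_mem_obj _ S.θ_mem_obj _ S.θ_mem_obj,
    S.cat.ε_id_right S.θ_mem_obj, one_mul, ← mul_assoc] at h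
  exact h

theorem eq_θ_mul_of_mem {q : N} (hq : q ∈ Intertwiners (S.θ.comp S.θ) (StarAlgHom.id ℂ N)) :
    q = S.θ q * S.braid * S.θ S.braid := by
  have h := S.cat.natural_left S.θθ_mem_obj S.cat.id_mem S.θ_mem_obj hq
  rw [S.cat.hexagon_left _ S.θ_mem_obj _ S.θ_mem_obj _ S.θ_mem_obj,
    S.cat.ε_id_left S.θ_mem_obj, one_mul, ← mul_assoc] at h
  exact h

/-! ### The two embeddings, realized in `N` -/

/-- The right embedding `m ↦ θ(ι'(m))` of `M` into `N`. -/
def embR : M →⋆ₐ[ℂ] N := S.θ.comp S.ι'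

/-- The left embedding `m ↦ ε θ(ι'(m)) ε*` of `M` into `N`. -/
def embL : M →⋆ₐ[ℂ] N where
  toFun m := S.braid * S.θ (S.ι' m) * star S.braid
  map_one' := by rw [map_one, map_one, mul_one, S.braid_mul_star_braid]
  map_mul' a b := by
    rw [map_mul, map_mul]
    calc S.braid * (S.θ (S.ι' a) * S.θ (S.ι' b)) * star S.braid
        = S.braid * S.θ (S.ι' a) * 1 * S.θ (S.ι' b) * star S.braid := by
          simp only [mul_one, mul_assoc]
      _ = _ := by rw [← S.star_braid_mul_braid]; simp only [mul_assoc]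
  map_zero' := by rw [map_zero, map_zero, mul_zero, zero_mul]
  map_add' a b := by rw [map_add, map_add, mul_add, add_mul]
  commutes' c := by
    rw [Algebra.algebraMap_eq_smul_one, Algebra.algebraMap_eq_smul_one, map_smul, map_one, map_smul,
      map_one, mul_smul_comm, mul_one, smul_mul_assoc, S.braid_mul_star_braid]
  map_star' a := by
    rw [star_mul, star_mul, star_star, map_star, map_star, mul_assoc]

theorem embL_apply (m : M) : S.embL m = S.braid * S.θ (S.ι' m) * star S.braid := rfl

theorem embR_apply (m : M) : S.embR m = S.θ (S.ι' m) := rfl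

theorem Θuni_apply (n : N) : S.Θuni n = S.θ (S.θ n) := rfl

theorem embR_ι (n : N) : S.embR (S.ι n) = S.Θuni n := rfl

theorem embL_ι (n : N) : S.embL (S.ι n) = S.Θuni n := by
  change S.braid * S.θ (S.θ n) * star S.braid = S.θ (S.θ n)
  rw [S.braid_mul, mul_assoc, S.braid_mul_star_braid, mul_one]

theorem embR_v : S.embR S.v = S.θ S.x := rfl

theorem embL_v : S.embL S.v = S.θ (star S.braid) * S.x := by
  have h : S.θ (star S.braid) * S.θ S.braid = 1 := by
    rw [← map_mul, S.star_braid_mul_braid, map_one]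
  change S.braid * S.θ S.x * star S.braid = _
  calc S.braid * S.θ S.x * star S.braid
      = S.θ (star S.braid) * (S.θ S.braid * S.braid * S.θ S.x) * star S.braid := by
        simp only [← mul_assoc, h, one_mul]
    _ = S.θ (star S.braid) * S.x := by
        rw [S.θ_braid_mul_braid_mul_θ_x, mul_assoc, mul_assoc, S.braid_mul_star_braid, mul_one]

theorem Xuni_eq : S.Xuni = S.embL S.v * S.embR S.v := by
  rw [embL_v, embR_v, mul_assoc]; rfl

/-- The exchange relation of the braided product: reordering the two generators costs one ε*, which
belongs to `N`. -/
theorem embR_v_mul_embL_v : S.embR S.v * S.embL S.v = S.Θuni (star S.braid) * S.Xuni := by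
  have h1 : S.x * star S.braid = S.θ (star S.braid) * star S.braid * S.θ S.x := by
    have h2 : S.θ (star S.braid) * star S.braid * (S.braid * S.θ S.braid) = 1 := by
      rw [mul_assoc, ← mul_assoc (star S.braid), S.star_braid_mul_braid, one_mul, ← map_mul,
        S.star_braid_mul_braid, map_one]
    calc S.x * star S.braid
        = S.θ (star S.braid) * star S.braid * (S.braid * S.θ S.braid * S.x) * star S.braid := by
          rw [← mul_assoc, h2, one_mul]
      _ = _ := by
          rw [S.braid_mul_θ_braid_mul_x]
          simp only [mul_assoc, S.braid_mul_star_braid, mul_one]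
  rw [embR_v, embL_v, Xuni, ← mul_assoc, ← map_mul, h1, Θuni_apply, S.x_mul, map_mul, map_mul]
  simp only [mul_assoc]
  rfl

/-- Hence a homomorphism on `M` is determined by its restriction to `N` and its value at v. -/
theorem eq_mul_v (m : M) : m = S.ι (star S.w * S.ι' m) * S.v := by
  rw [map_mul, mul_assoc, ← S.sol.right_mul, ← mul_assoc, S.sol.conj_left, one_mul]

theorem emb_v_mul_Θuni {f : M →⋆ₐ[ℂ] N} (hf : ∀ n, f (S.ι n) = S.Θuni n) (n : N) :
    f S.v * S.Θuni n = S.Θuni (S.θ n) * f S.v := by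
  rw [← hf, ← hf, ← map_mul, S.sol.right_mul, map_mul]; rfl

theorem emb_v_mul_emb_v {f : M →⋆ₐ[ℂ] N} (hf : ∀ n, f (S.ι n) = S.Θuni n) :
    f S.v * f S.v = S.Θuni S.x * f S.v := by
  rw [← map_mul, S.sol.right_mul, map_mul, hf]; rfl

theorem Θuni_mul_emb_v {f : M →⋆ₐ[ℂ] N} (hf : ∀ n, f (S.ι n) = S.Θuni n) :
    S.Θuni (star S.w) * f S.v = 1 := by
  rw [← hf, ← map_mul, S.sol.conj_left, map_one]

theorem emb_eq {f : M →⋆ₐ[ℂ] N} (hf : ∀ n, f (S.ι n) = S.Θuni n) (m : M) :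
    f m = S.Θuni (star S.w * S.ι' m) * f S.v := by
  conv_lhs => rw [S.eq_mul_v m, map_mul, hf]

theorem coe_vL : (S.vL : N) = S.embL S.v := by
  change S.Θuni (S.θ (star S.w)) * S.Xuni = _
  rw [S.Xuni_eq, ← mul_assoc, ← S.emb_v_mul_Θuni S.embL_ι, mul_assoc, S.Θuni_mul_emb_v S.embR_ι,
    mul_one]

theorem coe_vR : (S.vR : N) = S.embR S.v := by
  change S.Θuni (star S.w) * S.Xuni = _
  rw [S.Xuni_eq, ← mul_assoc, S.Θuni_mul_emb_v S.embL_ι, one_mul]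

theorem coe_jL (m : M) : (S.jL m : N) = S.embL m := by
  change S.Θuni (star S.w * S.ι' m) * (S.vL : N) = _
  rw [coe_vL, ← S.emb_eq S.embL_ι]

theorem coe_jR (m : M) : (S.jR m : N) = S.embR m := by
  change S.Θuni (star S.w * S.ι' m) * (S.vR : N) = _
  rw [coe_vR, ← S.emb_eq S.embR_ι]

theorem θ_injective : Function.Injective S.θ :=
  S.sol.symm.injective.comp S.sol.injective

theorem embR_injective : Function.Injective S.embR :=
  S.θ_injective.comp S.sol.symm.injective

theorem embL_injective : Function.Injective S.embL := by
  intro a b hab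
  refine S.embR_injective ?_
  have h : ∀ m, S.embR m = star S.braid * S.embL m * S.braid := fun m => by
    rw [embL_apply, embR_apply, mul_assoc, mul_assoc _ (star S.braid), S.star_braid_mul_braid,
      mul_one, ← mul_assoc, S.star_braid_mul_braid, one_mul]
  rw [h, h, hab]

/-- The left embedding of `M` into `C_uni`. -/
def homL : M →⋆ₐ[ℂ] S.Cuni :=
  S.embL.codRestrict S.Cuni fun m => S.coe_jL m ▸ (S.jL m).2

/-- The right embedding of `M` into `C_uni`. -/
def homR : M →⋆ₐ[ℂ] S.Cuni :=
  S.embR.codRestrict S.Cuni fun m => S.coe_jR m ▸ (S.jR m).2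

theorem homL_apply (m : M) : S.homL m = S.jL m := Subtype.ext (S.coe_jL m).symm

theorem homR_apply (m : M) : S.homR m = S.jR m := Subtype.ext (S.coe_jR m).symm

/-! ### The form of the elements of `C_uni` -/

theorem Xuni_mul_Θuni (n : N) : S.Xuni * S.Θuni n = S.Θuni (S.θ (S.θ n)) * S.Xuni := by
  rw [S.Xuni_eq, mul_assoc, S.emb_v_mul_Θuni S.embR_ι, ← mul_assoc, S.emb_v_mul_Θuni S.embL_ι,
    mul_assoc]

theorem embL_v_mul_Xuni : S.embL S.v * S.Xuni = S.Θuni S.x * S.Xuni := by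
  rw [S.Xuni_eq, ← mul_assoc, S.emb_v_mul_emb_v S.embL_ι, mul_assoc]

theorem Xuni_mul_embR_v : S.Xuni * S.embR S.v = S.Θuni (S.θ S.x) * S.Xuni := by
  rw [S.Xuni_eq, mul_assoc, S.emb_v_mul_emb_v S.embR_ι, ← mul_assoc, S.emb_v_mul_Θuni S.embL_ι,
    mul_assoc]

theorem embR_v_mul_Xuni :
    S.embR S.v * S.Xuni = S.Θuni (star S.braid * S.θ S.x) * S.Xuni := by
  conv_lhs => rw [S.Xuni_eq, ← mul_assoc, S.embR_v_mul_embL_v, mul_assoc, S.Xuni_mul_embR_v]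
  rw [← mul_assoc, ← map_mul]

theorem Xuni_mul_embL_v :
    S.Xuni * S.embL S.v = S.Θuni (S.θ (star S.braid) * S.x) * S.Xuni := by
  conv_lhs => rw [S.Xuni_eq, mul_assoc, S.embR_v_mul_embL_v, ← mul_assoc,
    S.emb_v_mul_Θuni S.embL_ι, mul_assoc, S.embL_v_mul_Xuni]
  rw [← mul_assoc, ← map_mul]

theorem one_eq_Θuni_mul_Xuni : 1 = S.Θuni (star S.w * star S.w) * S.Xuni := by
  rw [map_mul, mul_assoc, S.Xuni_eq, ← mul_assoc (S.Θuni _) (S.embL S.v),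
    S.Θuni_mul_emb_v S.embL_ι, one_mul, S.Θuni_mul_emb_v S.embR_ι]

theorem exists_star_Xuni : ∃ n, star S.Xuni = S.Θuni n * S.Xuni := by
  refine ⟨star S.w * S.ι' (star S.v) * (S.θ (star S.w * S.ι' (star S.v)) * star S.braid), ?_⟩
  conv_lhs => rw [S.Xuni_eq, star_mul, ← map_star, ← map_star, S.emb_eq S.embL_ι,
    S.emb_eq S.embR_ι, mul_assoc, ← mul_assoc (S.embR S.v), S.emb_v_mul_Θuni S.embR_ι,
    mul_assoc (S.Θuni (S.θ _)), S.embR_v_mul_embL_v]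
  simp only [map_mul, mul_assoc]

theorem exists_eq_Θuni_mul_Xuni {c : N} (hc : c ∈ S.Cuni) : ∃ n, c = S.Θuni n * S.Xuni := by
  have hΘ : ∀ n, ∃ k, S.Θuni n = S.Θuni k * S.Xuni := fun n =>
    ⟨n * (star S.w * star S.w), by
      rw [map_mul, mul_assoc, ← S.one_eq_Θuni_mul_Xuni, mul_one]⟩
  have hmul : ∀ a b, ∃ k, S.Θuni a * S.Xuni * (S.Θuni b * S.Xuni) = S.Θuni k * S.Xuni := by
    intro a b
    -- Obtained by moving b left past X_uni and reducing X_uni² with the exchange relation and v² =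
    -- ι(x)v.
    refine ⟨a * (S.θ (S.θ b) * (S.θ (star S.braid * S.θ S.x) * S.x)), ?_⟩
    have h1 : S.Xuni * S.Xuni = S.Θuni (S.θ (star S.braid * S.θ S.x) * S.x) * S.Xuni := by
      conv_lhs => rw [S.Xuni_eq, mul_assoc, ← S.Xuni_eq, S.embR_v_mul_Xuni, ← mul_assoc,
        S.emb_v_mul_Θuni S.embL_ι, mul_assoc, S.embL_v_mul_Xuni, ← mul_assoc, ← map_mul]
    rw [mul_assoc, ← mul_assoc S.Xuni, S.Xuni_mul_Θuni, mul_assoc, h1]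
    simp only [map_mul, mul_assoc]
  induction hc using StarAlgebra.adjoin_induction with
  | mem y hy =>
    rcases hy with ⟨n, rfl⟩ | hy
    · exact hΘ n
    · exact ⟨1, by rw [Set.mem_singleton_iff.mp hy, map_one, one_mul]⟩
  | algebraMap z =>
    obtain ⟨k, hk⟩ := hΘ 1
    refine ⟨z • k, ?_⟩
    rw [map_smul, smul_mul_assoc, ← hk, map_one, Algebra.algebraMap_eq_smul_one]
  | add y z _ _ hy hz =>
    obtain ⟨a, rfl⟩ := hy
    obtain ⟨b, rfl⟩ := hz
    exact ⟨a + b, by rw [map_add, add_mul]⟩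
  | mul y z _ _ hy hz =>
    obtain ⟨a, rfl⟩ := hy
    obtain ⟨b, rfl⟩ := hz
    exact hmul a b
  | star y _ hy =>
    obtain ⟨a, rfl⟩ := hy
    obtain ⟨n, hn⟩ := S.exists_star_Xuni
    refine ⟨n * S.θ (S.θ (star a)), ?_⟩
    rw [star_mul, hn, ← map_star, mul_assoc, S.Xuni_mul_Θuni, map_mul, mul_assoc]

theorem exists_eq_ιuni_mul_Vuni (c : S.Cuni) : ∃ n : N, c = S.ιuni n * S.Vuni := by
  obtain ⟨n, hn⟩ := S.exists_eq_Θuni_mul_Xuni c.2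
  exact ⟨n, Subtype.ext hn⟩

/-! ### The relative commutant of `N` in `C_uni`, and the centre -/

theorem braid_mul_w : S.braid * S.w = S.θ S.w := by
  have h := S.cat.natural_left S.cat.id_mem S.θ_mem_obj S.θ_mem_obj
    (t := S.w) S.sol.left_mem
  rwa [S.cat.ε_id_left S.θ_mem_obj, mul_one] at h

theorem star_w_mul (n : N) : star S.w * S.θ n = n * star S.w := S.sol.star_left_mul n

theorem star_x_mul (n : N) : star S.x * S.θ (S.θ n) = S.θ n * star S.x :=
  Intertwiners.star_mem S.x_mem n

theorem Xuni_eq_θ_mul : S.Xuni = S.θ (star S.braid * S.θ S.x) * S.x := by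
  rw [Xuni, S.x_mul, map_mul, mul_assoc]; rfl

/-- Multiplying on the left by w* twice undoes n ↦ θθ(n)X_uni. Uniqueness of the coefficient turns
commutation with `N` into an intertwining condition. -/
theorem Θuni_mul_Xuni_injective {n k : N} (h : S.Θuni n * S.Xuni = S.Θuni k * S.Xuni) :
    n = k := by
  have h1 : ∀ n, star S.w * (star S.w * (S.Θuni n * S.Xuni)) = n := by
    intro n
    have h2 : star S.w * S.Xuni = star S.braid * S.θ S.x := by
      rw [Xuni_eq_θ_mul, ← mul_assoc, star_w_mul, mul_assoc, star_w_mul_x, mul_one]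
    have h3 : star S.w * star S.braid = S.θ (star S.w) := by
      rw [← star_mul, S.braid_mul_w, map_star]
    rw [Θuni_apply, ← mul_assoc (star S.w) (S.θ _), star_w_mul, mul_assoc, h2,
      ← mul_assoc (star S.w), star_w_mul, mul_assoc, ← mul_assoc (star S.w), h3, ← map_mul,
      star_w_mul_x, map_one, mul_one]
  rw [← h1 n, h, h1 k]

theorem exists_intertwiner_of_commute {c : N} (hc : c ∈ S.Cuni)
    (hcomm : ∀ n, c * S.Θuni n = S.Θuni n * c) :
    ∃ q ∈ Intertwiners (S.θ.comp S.θ) (StarAlgHom.id ℂ N), c = S.Θuni q * S.Xuni := by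
  obtain ⟨q, rfl⟩ := S.exists_eq_Θuni_mul_Xuni hc
  refine ⟨q, fun n => S.Θuni_mul_Xuni_injective ?_, rfl⟩
  have h := hcomm n
  rw [mul_assoc, S.Xuni_mul_Θuni, ← mul_assoc, ← mul_assoc, ← map_mul, ← map_mul] at h
  exact h

/-- Commutativity of the Q-system enters here: pulling θ(q) through the braiding cancels the ε* in
X_uni and leaves an ε that x absorbs. -/
theorem Θuni_mul_Xuni_eq {q : N} (hq : q ∈ Intertwiners (S.θ.comp S.θ) (StarAlgHom.id ℂ N)) :
    S.Θuni q * S.Xuni = S.ι' (S.ι (q * S.θ S.x) * S.v) := by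
  have h1 : S.θ q * (star S.braid * S.θ S.x) = q * S.θ S.x := by
    rw [S.θ_eq_mul_of_mem hq, ← mul_assoc, mul_assoc _ S.braid, S.braid_mul_star_braid, mul_one,
      mul_assoc, ← map_mul, S.braid_mul_x]
  rw [Xuni_eq_θ_mul, Θuni_apply, ← mul_assoc, ← map_mul, h1]
  exact (map_mul S.ι' _ _).symm

theorem commute_embR_v {q : N} (hq : q ∈ Intertwiners (S.θ.comp S.θ) (StarAlgHom.id ℂ N)) :
    S.Θuni q * S.Xuni * S.embR S.v = S.embR S.v * (S.Θuni q * S.Xuni) := by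
  have h1 : S.θ q * (star S.braid * S.θ S.x) = q * S.θ S.x := by
    rw [S.θ_eq_mul_of_mem hq, ← mul_assoc, mul_assoc _ S.braid, S.braid_mul_star_braid, mul_one,
      mul_assoc, ← map_mul, S.braid_mul_x]
  rw [mul_assoc, S.Xuni_mul_embR_v, ← mul_assoc (S.embR S.v), S.emb_v_mul_Θuni S.embR_ι,
    mul_assoc, S.embR_v_mul_Xuni, ← mul_assoc, ← mul_assoc, ← map_mul, ← map_mul, h1]

theorem commute_embL_v {q : N} (hq : q ∈ Intertwiners (S.θ.comp S.θ) (StarAlgHom.id ℂ N)) :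
    S.Θuni q * S.Xuni * S.embL S.v = S.embL S.v * (S.Θuni q * S.Xuni) := by
  have h1 : q * (S.θ (star S.braid) * S.x) = S.θ q * S.x := by
    conv_lhs => rw [S.eq_θ_mul_of_mem hq]
    rw [← mul_assoc, mul_assoc _ (S.θ S.braid), ← map_mul, S.braid_mul_star_braid, map_one,
      mul_one, mul_assoc, S.braid_mul_x]
  rw [mul_assoc, S.Xuni_mul_embL_v, ← mul_assoc (S.embL S.v), S.emb_v_mul_Θuni S.embL_ι,
    mul_assoc, S.embL_v_mul_Xuni, ← mul_assoc, ← mul_assoc, ← map_mul, ← map_mul, h1]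

theorem commute_Θuni {q : N} (hq : q ∈ Intertwiners (S.θ.comp S.θ) (StarAlgHom.id ℂ N)) (n : N) :
    S.Θuni q * S.Xuni * S.Θuni n = S.Θuni n * (S.Θuni q * S.Xuni) := by
  have h1 : q * S.θ (S.θ n) = n * q := hq n
  rw [mul_assoc, S.Xuni_mul_Θuni, ← mul_assoc, ← mul_assoc, ← map_mul, ← map_mul, h1]

theorem commute_of_mem_Cuni {q c : N}
    (hq : q ∈ Intertwiners (S.θ.comp S.θ) (StarAlgHom.id ℂ N)) (hc : c ∈ S.Cuni) :
    S.Θuni q * S.Xuni * c = c * (S.Θuni q * S.Xuni) := by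
  obtain ⟨n, rfl⟩ := S.exists_eq_Θuni_mul_Xuni hc
  have hR := S.commute_embR_v hq
  have hL := S.commute_embL_v hq
  have hn := S.commute_Θuni hq n
  set z := S.Θuni q * S.Xuni
  rw [S.Xuni_eq, ← mul_assoc, hn, mul_assoc, ← mul_assoc z, hL, mul_assoc (S.embL _), hR]
  simp only [mul_assoc]

/-- ι' is injective and ι'(γ(m)) = θ(ι'(m)) is the right embedding, so centrality in C_uni
translates into commutation with γ(M). -/
theorem ι_mul_θ_x_mul_v_mem {q : N}
    (hq : q ∈ Intertwiners (S.θ.comp S.θ) (StarAlgHom.id ℂ N)) :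
    S.ι (q * S.θ S.x) * S.v ∈ Intertwiners S.γ S.γ := by
  intro m
  refine S.sol.symm.injective ?_
  rw [map_mul S.ι' _ (S.γ m), map_mul S.ι' (S.γ m), ← S.Θuni_mul_Xuni_eq hq]
  change _ * S.embR m = S.embR m * _
  exact S.commute_of_mem_Cuni hq (S.coe_jR m ▸ (S.jR m).2)

theorem fourierInv_mem {e : M} (he : e ∈ Intertwiners S.γ S.γ) :
    S.fourierInv e ∈ Intertwiners S.θ S.θ := by
  intro n
  have h1 : S.ι' e * S.θ (S.θ n) = S.θ (S.θ n) * S.ι' e := by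
    change S.ι' e * S.ι' (S.ι (S.ι' (S.ι n))) = S.ι' (S.ι (S.ι' (S.ι n))) * S.ι' e
    rw [← map_mul, ← map_mul]; exact congrArg S.ι' (he (S.ι n))
  rw [fourierInv, mul_assoc, S.w_mul, ← mul_assoc, mul_assoc (S.θ _), h1, ← mul_assoc, ← map_mul,
    star_w_mul, map_mul]
  simp only [mul_assoc]

theorem frobInv_mem {I : N} (hI : I ∈ Intertwiners S.θ S.θ) :
    S.frobInv I ∈ Intertwiners (S.θ.comp S.θ) (StarAlgHom.id ℂ N) := by
  intro n
  change S.frobInv I * S.θ (S.θ n) = n * S.frobInv I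
  rw [frobInv, mul_assoc, ← map_mul, hI, map_mul, ← mul_assoc, mul_assoc (star S.w), star_x_mul,
    ← mul_assoc (star S.w), star_w_mul]
  simp only [mul_assoc]

theorem ι_star_w_star_x_mul_v : S.ι (star S.w * star S.x) * S.v = star S.v := by
  have h : star S.x = S.ι' (star S.v) := (map_star S.ι' S.v).symm
  rw [h, ← S.eq_mul_v]

theorem Θuni_frobInv_fourierInv {e : M} (he : e ∈ Intertwiners S.γ S.γ) :
    S.Θuni (S.frobInv (S.fourierInv e)) * S.Xuni = S.ι' e := by
  rw [S.Θuni_mul_Xuni_eq (S.frobInv_mem (S.fourierInv_mem he))]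
  congr 1
  rw [frobInv, mul_assoc, ← map_mul, map_mul S.ι (star S.w * star S.x)]
  change _ * S.ι (S.ι' (S.ι _)) * _ = _
  rw [mul_assoc, ← S.sol.right_mul, ← mul_assoc, ι_star_w_star_x_mul_v, map_mul, ← mul_assoc]
  exact S.fourier_fourierInv e he

theorem ι'_mem_Cuni {e : M} (he : e ∈ Intertwiners S.γ S.γ) : S.ι' e ∈ S.Cuni := by
  rw [← S.Θuni_frobInv_fourierInv he]
  exact (S.ιuni _ * S.Vuni).2

theorem ι'_commute {e : M} (he : e ∈ Intertwiners S.γ S.γ) {c : N} (hc : c ∈ S.Cuni) :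
    S.ι' e * c = c * S.ι' e := by
  rw [← S.Θuni_frobInv_fourierInv he]
  exact S.commute_of_mem_Cuni (S.frobInv_mem (S.fourierInv_mem he)) hc

theorem coe_E {s : M} (hs : s * star s ∈ Intertwiners S.γ S.γ) :
    (S.E s : N) = S.ι' (s * star s) :=
  S.Θuni_frobInv_fourierInv hs

theorem E_mem_center {s : M} (hs : s * star s ∈ Intertwiners S.γ S.γ) :
    S.E s ∈ Set.center S.Cuni := by
  refine Semigroup.mem_center_iff.mpr fun c => Subtype.ext ?_
  change (c : N) * (S.E s : N) = (S.E s : N) * (c : N)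
  rw [S.coe_E hs, S.ι'_commute hs c.2]

/-- The relative commutant of `N` in `C_uni` is contained in `ι'(Hom(γ, γ))`. -/
theorem exists_coe_eq_of_commute {c : N} (hc : c ∈ S.Cuni)
    (hcomm : ∀ n, c * S.Θuni n = S.Θuni n * c) :
    ∃ f ∈ Intertwiners S.γ S.γ, c = S.ι' f := by
  obtain ⟨q, hq, rfl⟩ := S.exists_intertwiner_of_commute hc hcomm
  exact ⟨_, S.ι_mul_θ_x_mul_v_mem hq, S.Θuni_mul_Xuni_eq hq⟩

theorem exists_coe_eq_of_mem_center {c : S.Cuni} (hc : c ∈ Set.center S.Cuni) :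
    ∃ f ∈ Intertwiners S.γ S.γ, (c : N) = S.ι' f := by
  refine S.exists_coe_eq_of_commute c.2 fun n => ?_
  exact (congrArg Subtype.val (Semigroup.mem_center_iff.mp hc (S.ιuni n))).symm

/-- `Hom(γ, γ)` is commutative. -/
theorem γ_intertwiners_commute {e f : M} (he : e ∈ Intertwiners S.γ S.γ)
    (hf : f ∈ Intertwiners S.γ S.γ) : e * f = f * e := by
  refine S.sol.symm.injective ?_
  rw [map_mul, map_mul, S.ι'_commute he (S.ι'_mem_Cuni hf)]

/-- The element of `Hom(γ, γ)` which corresponds to a product `jᴸ(m) jᴿ(m')` in the relative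
commutant of `N`. -/
theorem embL_mul_embR_eq {m m' : M}
    (h : ∀ n, S.embL m * S.embR m' * S.Θuni n = S.Θuni n * (S.embL m * S.embR m')) :
    m * S.ι (star S.w * S.ι' (m' * S.v)) ∈ Intertwiners S.γ S.γ ∧
      S.embL m * S.embR m' = S.ι' (m * S.ι (star S.w * S.ι' (m' * S.v))) := by
  have hmem : S.embL m * S.embR m' ∈ S.Cuni :=
    S.Cuni.mul_mem (S.coe_jL m ▸ (S.jL m).2) (S.coe_jR m' ▸ (S.jR m').2)
  obtain ⟨q, hq, hq2⟩ := S.exists_intertwiner_of_commute hmem h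
  -- The coefficient is read off by uniqueness after moving both factors into the form θθ(·)X_uni.
  have hqe : q = star S.w * S.ι' m * S.θ (star S.w * S.ι' m') := by
    refine S.Θuni_mul_Xuni_injective ?_
    rw [← hq2, S.emb_eq S.embL_ι, S.emb_eq S.embR_ι m', S.Xuni_eq, mul_assoc,
      ← mul_assoc (S.embL S.v), S.emb_v_mul_Θuni S.embL_ι, map_mul S.Θuni (star S.w * S.ι' m)]
    simp only [mul_assoc]
  have hf : S.ι (q * S.θ S.x) * S.v = m * S.ι (star S.w * S.ι' (m' * S.v)) := by
    rw [hqe, mul_assoc, ← map_mul, map_mul S.ι (star S.w * S.ι' m)]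
    change _ * S.ι (S.ι' (S.ι _)) * _ = _
    rw [mul_assoc, ← S.sol.right_mul, ← mul_assoc, ← S.eq_mul_v, map_mul S.ι' m', mul_assoc]
    rfl
  rw [hq2, ← hf]
  exact ⟨S.ι_mul_θ_x_mul_v_mem hq, S.Θuni_mul_Xuni_eq hq⟩

end LocalExtension

/-! ### Coordinates in an orthonormal basis of intertwiners -/

namespace IsOrthonormalBasisOfIntertwiners

variable {A B : Type*} [CStarAlgebra A] [CStarAlgebra B] {m : ℕ} {φ₁ φ₂ : A →⋆ₐ[ℂ] B}
  {ψ : Fin m → B} (h : IsOrthonormalBasisOfIntertwiners φ₁ φ₂ ψ)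
include h

theorem star_mul_sum (c : Fin m → ℂ) (k : Fin m) :
    star (ψ k) * ∑ j, c j • ψ j = c k • (1 : B) := by
  rw [Finset.mul_sum, Finset.sum_eq_single k]
  · rw [mul_smul_comm, h.orthonormal, if_pos rfl]
  · intro j _ hj
    rw [mul_smul_comm, h.orthonormal, if_neg hj.symm, smul_zero]
  · exact fun hk => absurd (Finset.mem_univ k) hk

theorem exists_eq_sum {b : B} (hb : b ∈ Intertwiners φ₁ φ₂) :
    ∃ c : Fin m → ℂ, b = ∑ j, c j • ψ j := by
  rw [← h.span_eq] at hb
  obtain ⟨c, hc⟩ := (Submodule.mem_span_range_iff_exists_fun ℂ).mp hb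
  exact ⟨c, hc.symm⟩

end IsOrthonormalBasisOfIntertwiners

namespace LocalExtension

variable {N M : Type*} [CStarAlgebra N] [CStarAlgebra M] (S : LocalExtension N M)

/-! ### The minimal central projections -/

section CentralProjections

variable {K : Type*} [Fintype K] {γs : K → (M →⋆ₐ[ℂ] M)} {s : K → M}
  (hs : IsDirectSumHom S.γ γs s)
include hs

theorem proj_mem (a : K) : s a * star (s a) ∈ Intertwiners S.γ S.γ :=
  Intertwiners.mul_mem (hs.mem a) (Intertwiners.star_mem (hs.mem a))

omit hs in
theorem proj_mul_proj {t : M} (ht : star t * t = 1) : t * star t * (t * star t) = t * star t := by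
  rw [mul_assoc, ← mul_assoc (star t), ht, one_mul]

/-- Since Hom(γ, γ) is abelian, f e_a = e_a f e_a = s_a(s_a* f s_a)s_a*, and the middle factor is a
scalar by irreducibility of γ_a. -/
theorem exists_mul_proj_eq_smul (hγ : ∀ a, IsIrreducibleHom (γs a)) {f : M}
    (hf : f ∈ Intertwiners S.γ S.γ) (a : K) :
    ∃ c : ℂ, f * (s a * star (s a)) = c • (s a * star (s a)) := by
  obtain ⟨c, hc⟩ := hγ a (star (s a) * f * s a) (Intertwiners.mul_mem (Intertwiners.mul_mem
    (Intertwiners.star_mem (hs.mem a)) hf) (hs.mem a))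
  refine ⟨c, ?_⟩
  calc f * (s a * star (s a)) = f * (s a * star (s a)) * (s a * star (s a)) := by
        rw [mul_assoc f, proj_mul_proj (hs.isometry a)]
    _ = s a * (star (s a) * f * s a) * star (s a) := by
        rw [S.γ_intertwiners_commute hf (S.proj_mem hs a)]; simp only [mul_assoc]
    _ = c • (s a * star (s a)) := by rw [hc, mul_smul_comm, mul_one, smul_mul_assoc]

omit hs in
theorem proj_ne_zero [Nontrivial M] {t : M} (ht : star t * t = 1) : t * star t ≠ 0 := by
  intro h
  have h1 : star t * (t * star t) * t = 1 := by rw [← mul_assoc, ht, one_mul, ht]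
  rw [h, mul_zero, zero_mul] at h1
  exact zero_ne_one h1

theorem E_injective [Nontrivial M] : Function.Injective fun a => S.E (s a) := by
  intro a b hab
  by_contra hne
  have h1 : s a * star (s a) = s b * star (s b) := by
    refine S.sol.symm.injective ?_
    rw [← S.coe_E (S.proj_mem hs a), ← S.coe_E (S.proj_mem hs b)]
    exact congrArg Subtype.val hab
  refine proj_ne_zero (hs.isometry a) ?_
  rw [← proj_mul_proj (hs.isometry a)]
  conv_lhs => rw [h1]
  rw [← h1, mul_assoc, h1, ← mul_assoc (star (s a)), hs.star_mul_eq_zero hne, zero_mul, mul_zero]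

theorem E_isStarProjection (a : K) : IsStarProjection (S.E (s a)) := by
  have h := S.coe_E (S.proj_mem hs a)
  constructor
  · refine Subtype.ext ?_
    change (S.E (s a) : N) * (S.E (s a) : N) = (S.E (s a) : N)
    rw [h, ← map_mul, proj_mul_proj (hs.isometry a)]
  · refine Subtype.ext ?_
    change star (S.E (s a) : N) = (S.E (s a) : N)
    rw [h, ← map_star, star_mul, star_star]

theorem exists_mul_E_eq_smul (hγ : ∀ a, IsIrreducibleHom (γs a)) {c : S.Cuni}
    (hc : c ∈ Set.center S.Cuni) (a : K) : ∃ l : ℂ, c * S.E (s a) = l • S.E (s a) := by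
  obtain ⟨f, hf, hcf⟩ := S.exists_coe_eq_of_mem_center hc
  obtain ⟨l, hl⟩ := S.exists_mul_proj_eq_smul hs hγ hf a
  refine ⟨l, Subtype.ext ?_⟩
  change (c : N) * (S.E (s a) : N) = l • (S.E (s a) : N)
  rw [hcf, S.coe_E (S.proj_mem hs a), ← map_mul, hl, map_smul]

theorem E_ne_zero [Nontrivial M] (a : K) : S.E (s a) ≠ 0 := by
  intro h
  have h1 : S.ι' (s a * star (s a)) = 0 := by
    rw [← S.coe_E (S.proj_mem hs a), h]; rfl
  exact proj_ne_zero (hs.isometry a) (S.sol.symm.injective (h1.trans (map_zero _).symm))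

theorem sum_E : ∑ a, S.E (s a) = 1 := by
  refine Subtype.ext ?_
  rw [AddSubmonoidClass.coe_finsetSum]
  simp only [S.coe_E (S.proj_mem hs _)]
  rw [← map_sum, hs.sum_eq_one, map_one]
  rfl

theorem projection_mul_E [Nontrivial M] (hγ : ∀ a, IsIrreducibleHom (γs a)) {p : S.Cuni}
    (hp : IsStarProjection p) (hpc : p ∈ Set.center S.Cuni) (a : K) :
    p * S.E (s a) = 0 ∨ p * S.E (s a) = S.E (s a) := by
  obtain ⟨l, hl⟩ := S.exists_mul_E_eq_smul hs hγ hpc a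
  have h1 : l • S.E (s a) = (l * l) • S.E (s a) := by
    rw [← smul_smul, ← hl, ← mul_smul_comm, ← hl, ← mul_assoc, hp.isIdempotentElem]
  have h2 : (l * l - l) • S.E (s a) = 0 := by rw [sub_smul, ← h1, sub_self]
  have h3 : l * (l - 1) = 0 := by
    rw [mul_sub, mul_one]
    exact (smul_eq_zero.mp h2).resolve_right (S.E_ne_zero hs a)
  rcases mul_eq_zero.mp h3 with h4 | h4
  · left; rw [hl, h4, zero_smul]
  · right; rw [hl, sub_eq_zero.mp h4, one_smul]

theorem isMinimalCentralProjection_iff [Nontrivial M] (hγ : ∀ a, IsIrreducibleHom (γs a))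
    (p : S.Cuni) : IsMinimalCentralProjection p ↔ ∃ a, p = S.E (s a) := by
  have hcomm : ∀ {q : S.Cuni} (a : K), q ∈ Set.center S.Cuni → S.E (s a) * q = q * S.E (s a) :=
    fun a hq => Semigroup.mem_center_iff.mp hq _
  constructor
  · intro hp
    obtain ⟨a, ha⟩ : ∃ a, p * S.E (s a) ≠ 0 := by
      by_contra! h0
      refine hp.ne_zero ?_
      rw [← mul_one p, ← S.sum_E hs, Finset.mul_sum]
      exact Finset.sum_eq_zero fun a _ => h0 a
    refine ⟨a, ?_⟩
    have h1 := (S.projection_mul_E hs hγ hp.projection hp.central a).resolve_left ha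
    have h2 := hp.minimal (S.E (s a)) (S.E_isStarProjection hs a) (S.E_mem_center (S.proj_mem hs a))
      (by rw [hcomm a hp.central, h1])
    exact (h2.resolve_left (S.E_ne_zero hs a)).symm
  · rintro ⟨a, rfl⟩
    refine ⟨S.E_isStarProjection hs a, S.E_mem_center (S.proj_mem hs a), S.E_ne_zero hs a, ?_⟩
    intro q hq hqc hqa
    rcases S.projection_mul_E hs hγ hq hqc a with h | h
    · exact Or.inl (hqa.symm.trans h)
    · exact Or.inr (hqa.symm.trans h)

end CentralProjections

/-! ### The positive maps -/

theorem posMap_eq {γa : M →⋆ₐ[ℂ] M} {sa : M} (hsa : sa ∈ Intertwiners γa S.γ)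
    (hd : 0 ≤ homDim S.ι / homDim γa) (m : M) :
    S.posMap γa sa m = ((homDim S.ι / homDim γa : ℝ) : ℂ) •
      (S.ι (star S.w) * (S.γ m * (sa * star sa)) * S.ι S.w) := by
  have h1 : sa * γa m = S.γ m * sa := hsa m
  have h2 : ((Real.sqrt (homDim S.ι / homDim γa) : ℝ) : ℂ)
      * ((Real.sqrt (homDim S.ι / homDim γa) : ℝ) : ℂ) = ((homDim S.ι / homDim γa : ℝ) : ℂ) := by
    rw [← Complex.ofReal_mul, Real.mul_self_sqrt hd]
  rw [posMap, h, star_smul, smul_mul_assoc, smul_mul_assoc, mul_smul_comm, smul_smul,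
    Complex.star_def, Complex.conj_ofReal, h2, star_mul, star_star, ← map_star,
    mul_assoc (S.ι _) sa, h1]
  simp only [mul_assoc]

theorem posMap_star (γa : M →⋆ₐ[ℂ] M) (sa m : M) :
    S.posMap γa sa (star m) = star (S.posMap γa sa m) := by
  simp only [posMap, star_mul, star_star, map_star, mul_assoc]

theorem h_mem {γa : M →⋆ₐ[ℂ] M} {sa : M} (hsa : sa ∈ Intertwiners γa S.γ) :
    S.h γa sa ∈ Intertwiners S.ι (γa.comp S.ι) := by
  refine Submodule.smul_mem _ _ fun n => ?_
  have h1 : star sa * S.ι (S.ι' (S.ι n)) = γa (S.ι n) * star sa :=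
    Intertwiners.star_mem hsa (S.ι n)
  change _ = γa (S.ι n) * _
  rw [mul_assoc, ← map_mul, S.sol.left_mul, map_mul, ← mul_assoc, h1, mul_assoc]

theorem posMap_mem {γa : M →⋆ₐ[ℂ] M} {sa : M} (hsa : sa ∈ Intertwiners γa S.γ)
    {ρ : N →⋆ₐ[ℂ] N} {m : M} (hm : m ∈ Intertwiners S.ι (S.ι.comp ρ)) :
    S.posMap γa sa m ∈ Intertwiners S.ι (S.ι.comp ρ) := by
  intro n
  have h1 : ∀ n, S.h γa sa * S.ι n = γa (S.ι n) * S.h γa sa := S.h_mem hsa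
  have h2 : ∀ n, star (S.h γa sa) * γa (S.ι n) = S.ι n * star (S.h γa sa) :=
    Intertwiners.star_mem (S.h_mem hsa)
  have h3 : γa m * γa (S.ι n) = γa (S.ι (ρ n)) * γa m := by
    rw [← map_mul, ← map_mul]; exact congrArg γa (hm n)
  change _ = S.ι (ρ n) * _
  rw [posMap, mul_assoc, h1, ← mul_assoc, mul_assoc (star _), h3, ← mul_assoc, h2]
  simp only [mul_assoc]

theorem embL_mul_embR_commute {ρ : N →⋆ₐ[ℂ] N} {m m' : M}
    (hm : m ∈ Intertwiners (S.ι.comp ρ) S.ι) (hm' : m' ∈ Intertwiners S.ι (S.ι.comp ρ)) (n : N) :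
    S.embL m * S.embR m' * S.Θuni n = S.Θuni n * (S.embL m * S.embR m') := by
  have h1 : m * S.ι (ρ n) = S.ι n * m := hm n
  have h2 : m' * S.ι n = S.ι (ρ n) * m' := hm' n
  rw [← S.embR_ι, mul_assoc, ← map_mul, h2, map_mul, S.embR_ι, ← S.embL_ι, ← mul_assoc, ← map_mul,
    h1, map_mul, S.embL_ι, S.embR_ι, mul_assoc]

/-! ### The matrices U and the products of charged fields -/

section Matrices

variable [Nontrivial N] [Nontrivial M] [Algebra.IsCentral ℂ M]
  {K : Type*} [Fintype K] {γs : K → (M →⋆ₐ[ℂ] M)} {s : K → M}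
  (hs : IsDirectSumHom S.γ γs s) (hγ : ∀ a, IsIrreducibleHom (γs a))
include hs hγ

theorem homDim_pos_and_partial_trace (a : K) : 0 < homDim (γs a) ∧
    S.ι (star S.w) * (s a * star (s a)) * S.ι S.w =
      ((homDim (γs a) / homDim S.ι : ℝ) : ℂ) • (1 : M) := by
  have h := S.sol.partial_trace_isometry S.irreducible (hγ a) (hs.mem a) (hs.isometry a) hγ hs
  exact ⟨h.1, h.2.1⟩

theorem mul_proj_eq_smul_of_posMap {ρ : N →⋆ₐ[ℂ] N} {m m' : M}
    (hm : m ∈ Intertwiners (S.ι.comp ρ) S.ι) (hm' : m' ∈ Intertwiners S.ι (S.ι.comp ρ))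
    {a : K} {u : ℂ} (hu : m * S.posMap (γs a) (s a) m' = u • (1 : M)) :
    m * S.ι (star S.w * S.ι' (m' * S.v)) * (s a * star (s a)) = u • (s a * star (s a)) := by
  obtain ⟨hf, -⟩ := S.embL_mul_embR_eq (S.embL_mul_embR_commute hm hm')
  obtain ⟨c, hc⟩ := S.exists_mul_proj_eq_smul hs hγ hf a
  obtain ⟨hpos, htr⟩ := S.homDim_pos_and_partial_trace hs hγ a
  have hd := S.sol.param_pos
  have he := S.proj_mem hs a
  set e := s a * star (s a)
  have he' : ∀ y, e * S.ι (S.ι' y) = S.ι (S.ι' y) * e := he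
  -- G ∈ Hom(ιθ, ι) links both quantities: Gι(x) = c e_a is the spectral value sought, while Gι(w)
  -- is (dim γ_a / dim ι) m φ_a(m').
  set G := m * (S.ι (star S.w) * (S.ι (S.ι' m') * e)) with hG
  have hGn : ∀ n, G * S.ι (S.θ n) = S.ι n * G := by
    intro n
    have h2 : m' * S.ι n = S.ι (ρ n) * m' := hm' n
    have h3 : S.ι (S.ι' m') * S.ι (S.ι' (S.ι n)) = S.ι (S.ι' (S.ι (ρ n))) * S.ι (S.ι' m') := by
      rw [← map_mul, ← map_mul, h2, map_mul, map_mul]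
    have h4 : S.ι (star S.w) * S.ι (S.ι' (S.ι (ρ n))) = S.ι (ρ n) * S.ι (star S.w) := by
      rw [← map_mul, S.sol.star_left_mul, map_mul]
    have h5 : m * S.ι (ρ n) = S.ι n * m := hm n
    change G * S.ι (S.ι' (S.ι n)) = _
    calc G * S.ι (S.ι' (S.ι n))
        = m * (S.ι (star S.w) * (S.ι (S.ι' m') * (e * S.ι (S.ι' (S.ι n))))) := by
          simp only [hG, mul_assoc]
      _ = m * (S.ι (star S.w) * (S.ι (S.ι' m') * S.ι (S.ι' (S.ι n)) * e)) := by
          rw [he', mul_assoc]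
      _ = m * (S.ι (star S.w) * S.ι (S.ι' (S.ι (ρ n))) * (S.ι (S.ι' m') * e)) := by
          rw [h3]; simp only [mul_assoc]
      _ = m * S.ι (ρ n) * (S.ι (star S.w) * (S.ι (S.ι' m') * e)) := by
          rw [h4]; simp only [mul_assoc]
      _ = S.ι n * G := by rw [h5, mul_assoc]
  have hGv : G * S.ι S.x = c • e := by
    rw [← hc]
    change G * S.ι (S.ι' S.v) = _
    rw [hG, map_mul, map_mul, map_mul]
    simp only [mul_assoc]
    rw [he']
  have hGw : G * S.ι S.w = (c * ((homDim (γs a) / homDim S.ι : ℝ) : ℂ)) • (1 : M) := by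
    -- Inserting 1 = θ(w*)x turns Gι(w) into the partial trace of c e_a.
    calc G * S.ι S.w = G * S.ι (S.θ (star S.w) * S.x * S.w) := by
          rw [S.θ_star_w_mul_x, one_mul]
      _ = S.ι (star S.w) * (G * S.ι S.x) * S.ι S.w := by
          rw [map_mul, map_mul, ← mul_assoc, ← mul_assoc, hGn]; simp only [mul_assoc]
      _ = c • (S.ι (star S.w) * e * S.ι S.w) := by
          rw [hGv, mul_smul_comm, smul_mul_assoc]
      _ = _ := by rw [htr, smul_smul]
  have huc : u = c := by
    refine smul_one_injective (A := M) ?_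
    rw [← hu, S.posMap_eq (hs.mem a) (div_nonneg hd.le hpos.le), mul_smul_comm]
    change _ • (m * (S.ι (star S.w) * (S.ι (S.ι' m') * e) * S.ι S.w)) = _
    rw [← mul_assoc, hGw, smul_smul, mul_left_comm, ← Complex.ofReal_mul]
    have h9 : homDim S.ι / homDim (γs a) * (homDim (γs a) / homDim S.ι) = 1 := by
      field_simp
    rw [h9, Complex.ofReal_one, mul_one]
  rw [hc, huc]

theorem jL_mul_jR_eq_sum {m : ℕ} {ρ : N →⋆ₐ[ℂ] N} {ψ : Fin m → M}
    (hψ : IsOrthonormalBasisOfIntertwiners S.ι (S.ι.comp ρ) ψ)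
    {U : K → Matrix (Fin m) (Fin m) ℂ}
    (hU : ∀ a i, S.posMap (γs a) (s a) (ψ i) = ∑ j, U a j i • ψ j) (i j : Fin m) :
    S.jL (star (ψ j)) * S.jR (ψ i) = ∑ a, U a j i • S.E (s a) := by
  have hm := Intertwiners.star_mem (hψ.mem j)
  refine Subtype.ext ?_
  rw [AddSubmonoidClass.coe_finsetSum]
  change (S.jL (star (ψ j)) : N) * (S.jR (ψ i) : N) = ∑ a, U a j i • (S.E (s a) : N)
  rw [S.coe_jL, S.coe_jR, (S.embL_mul_embR_eq (S.embL_mul_embR_commute hm (hψ.mem i))).2]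
  conv_lhs => rw [← mul_one (star (ψ j) * _), ← hs.sum_eq_one, Finset.mul_sum, map_sum]
  refine Finset.sum_congr rfl fun a _ => ?_
  rw [S.coe_E (S.proj_mem hs a), S.mul_proj_eq_smul_of_posMap hs hγ hm (hψ.mem i) (u := U a j i),
    map_smul]
  rw [hU, hψ.star_mul_sum]

omit [Nontrivial N] [Algebra.IsCentral ℂ M] hγ in
theorem existsUnique_matrix {J : Type*} {m : J → ℕ} {θs : J → (N →⋆ₐ[ℂ] N)}
    {ψ : ∀ n, Fin (m n) → M}
    (hψ : ∀ n, IsOrthonormalBasisOfIntertwiners S.ι (S.ι.comp (θs n)) (ψ n)) :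
    ∃! U : ∀ n, K → Matrix (Fin (m n)) (Fin (m n)) ℂ,
      ∀ n a i, S.posMap (γs a) (s a) (ψ n i) = ∑ j, U n a j i • ψ n j := by
  have h : ∀ n a i, ∃ c : Fin (m n) → ℂ,
      S.posMap (γs a) (s a) (ψ n i) = ∑ j, c j • ψ n j := fun n a i =>
    (hψ n).exists_eq_sum (S.posMap_mem (hs.mem a) ((hψ n).mem i))
  choose c hc using h
  refine ⟨fun n a => Matrix.of fun j i => c n a i j, fun n a i => hc n a i, ?_⟩
  intro U hU
  funext n a
  ext j i
  refine smul_one_injective (A := M) ?_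
  rw [← (hψ n).star_mul_sum (fun j => U n a j i), ← hU, hc, (hψ n).star_mul_sum]
  rfl

end Matrices

/-! ### The completeness relation and the expansion of E_a -/

section Decomposition

variable [Nontrivial N] [Nontrivial M] [Algebra.IsCentral ℂ N]
  {J : Type*} [Fintype J] {m : J → ℕ} {θs : J → (N →⋆ₐ[ℂ] N)} {t : (Σ n, Fin (m n)) → N}
  (hθ : ∀ n, IsIrreducibleHom (θs n))
  (ht : IsDirectSumHom S.θ (fun p : Σ n, Fin (m n) => θs p.1) t)
include hθ ht

theorem homDim_pos_and_star_mul (n : J) (i j : Fin (m n)) : 0 < homDim (θs n) ∧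
    star (S.ι (star (t ⟨n, i⟩)) * S.v) * (S.ι (star (t ⟨n, j⟩)) * S.v) =
      if i = j then ((homDim (θs n) / homDim S.ι : ℝ) : ℂ) • (1 : M) else 0 := by
  have hirr := S.sol.irreducible_symm S.irreducible
  have hi := ht.isometry ⟨n, i⟩
  have h := S.sol.symm.partial_trace_isometry hirr (hθ n) (ht.mem ⟨n, i⟩) hi
    (fun p : Σ n, Fin (m n) => hθ p.1) ht
  refine ⟨h.1, ?_⟩
  have h1 : star (S.ι (star (t ⟨n, i⟩)) * S.v) * (S.ι (star (t ⟨n, j⟩)) * S.v) =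
      star S.v * S.ι (t ⟨n, i⟩ * star (t ⟨n, j⟩)) * S.v := by
    rw [star_mul, ← map_star, star_star, map_mul]
    simp only [mul_assoc]
  rw [h1]
  split_ifs with hij
  · rw [← hij]; exact h.2.2
  · refine S.sol.symm.partial_trace_orthogonal hirr (ht.mem ⟨n, i⟩) (ht.mem ⟨n, j⟩) hi
      (ht.star_mul_eq_zero fun hji => hij ?_)
    exact (eq_of_heq (Sigma.mk.inj hji).2).symm

variable {ψ : ∀ n, Fin (m n) → M}
  (hψ : ∀ n, IsOrthonormalBasisOfIntertwiners S.ι (S.ι.comp (θs n)) (ψ n))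
include hψ

/-- Frobenius reciprocity sends t_{n,i} to ι(t_{n,i}*)v in Hom(ι, ιθ_n). There these elements are
orthogonal with square norm dim θ_n / dim ι, so they differ from the ψ_{n,i} by a multiple of a
unitary matrix. -/
theorem sum_smul_eq_sum (n : J) :
    ∑ i, ((homDim (θs n) / homDim S.ι : ℝ) : ℂ) •
      (S.ι' (star (ψ n i)) * S.w * (star S.w * S.ι' (ψ n i))) =
    ∑ i, t ⟨n, i⟩ * star (t ⟨n, i⟩) := by
  -- An index is needed for dim θ_n > 0, which is derived from a copy of θ_n in θ.
  rcases isEmpty_or_nonempty (Fin (m n)) with he | ⟨⟨i₀⟩⟩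
  · rw [Finset.univ_eq_empty, Finset.sum_empty, Finset.sum_empty]
  have hχ : ∀ j, S.ι (star (t ⟨n, j⟩)) * S.v ∈ Intertwiners S.ι (S.ι.comp (θs n)) := by
    intro j k
    have h1 : star (t ⟨n, j⟩) * S.ι' (S.ι k) = θs n k * star (t ⟨n, j⟩) :=
      Intertwiners.star_mem (ht.mem ⟨n, j⟩) k
    change _ = S.ι (θs n k) * _
    rw [mul_assoc, S.sol.right_mul, ← mul_assoc, ← map_mul, h1, map_mul, mul_assoc]
  choose A hA using fun j => (hψ n).exists_eq_sum (hχ j)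
  set l : ℂ := ((homDim (θs n) / homDim S.ι : ℝ) : ℂ) with hl
  set g : Fin (m n) → N := fun k => star S.w * S.ι' (ψ n k) with hg
  have ht_eq : ∀ j, star (t ⟨n, j⟩) = ∑ k, A j k • g k := by
    intro j
    calc star (t ⟨n, j⟩) = star S.w * S.ι' (S.ι (star (t ⟨n, j⟩)) * S.v) := by
          rw [map_mul, ← mul_assoc, S.sol.star_left_mul, mul_assoc, S.sol.star_conj_right, mul_one]
      _ = ∑ k, A j k • g k := by
          rw [hA, map_sum, Finset.mul_sum]
          simp only [map_smul, mul_smul_comm, hg]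
  have hgram : ∀ i j, ∑ k, star (A i k) * A j k = if i = j then l else 0 := by
    intro i j
    refine smul_one_injective (A := M) ?_
    have h1 := (S.homDim_pos_and_star_mul hθ ht n i j).2
    rw [hA, hA, star_sum, Finset.sum_mul] at h1
    simp only [star_smul, smul_mul_assoc, (hψ n).star_mul_sum, smul_smul] at h1
    rw [Finset.sum_smul, h1, ite_smul, zero_smul]
  have hl0 : l ≠ 0 := by
    have h1 := (S.homDim_pos_and_star_mul hθ ht n i₀ i₀).1
    have h2 := S.sol.param_pos
    rw [hl]
    exact_mod_cast (div_pos h1 h2).ne'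
  -- A is square, so AA* = l·1 yields A*A = l·1.
  have hgram' : ∀ p k, ∑ j, star (A j p) * A j k = if p = k then l else 0 := by
    have h1 : (l⁻¹ • Matrix.of fun j k => A j k) * (Matrix.of fun j k => A j k).conjTranspose
        = 1 := by
      ext i j
      have h2 := hgram j i
      rw [Matrix.smul_mul, Matrix.smul_apply, Matrix.mul_apply, Matrix.one_apply]
      simp only [Matrix.conjTranspose_apply, Matrix.of_apply, smul_eq_mul]
      rw [Finset.sum_congr rfl fun k _ => mul_comm (A i k) (star (A j k)), h2]
      by_cases hij : i = j
      · rw [if_pos hij, if_pos hij.symm, inv_mul_cancel₀ hl0]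
      · rw [if_neg hij, if_neg (Ne.symm hij), mul_zero]
    have h3 := mul_eq_one_comm.mp h1
    intro p k
    have h4 := congrFun (congrFun h3 p) k
    rw [Matrix.mul_smul, Matrix.smul_apply, Matrix.mul_apply, Matrix.one_apply] at h4
    simp only [Matrix.conjTranspose_apply, Matrix.of_apply, smul_eq_mul] at h4
    rw [inv_mul_eq_iff_eq_mul₀ hl0] at h4
    rw [h4]
    split_ifs <;> simp
  have hgg : ∀ i, S.ι' (star (ψ n i)) * S.w * (star S.w * S.ι' (ψ n i)) = star (g i) * g i := by
    intro i
    rw [hg, star_mul, star_star, map_star]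
  symm
  calc ∑ j, t ⟨n, j⟩ * star (t ⟨n, j⟩)
      = ∑ j, star (∑ k, A j k • g k) * ∑ k, A j k • g k := by
        refine Finset.sum_congr rfl fun j _ => ?_
        rw [← ht_eq, star_star]
    _ = ∑ p, ∑ k, (∑ j, star (A j p) * A j k) • (star (g p) * g k) := by
        simp only [star_sum, star_smul, Finset.sum_mul_sum, smul_mul_smul_comm, Finset.sum_smul]
        rw [Finset.sum_comm]
        exact Finset.sum_congr rfl fun p _ => Finset.sum_comm
    _ = _ := by
        refine Finset.sum_congr rfl fun p _ => ?_
        rw [Finset.sum_eq_single p, hgram', if_pos rfl, hgg]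
        · intro k _ hk
          rw [hgram', if_neg hk.symm, zero_smul]
        · exact fun hp => absurd (Finset.mem_univ p) hp

theorem sum_sum_smul_eq_one :
    ∑ n, ∑ i, ((homDim (θs n) / homDim S.ι : ℝ) : ℂ) •
      (S.ι' (star (ψ n i)) * S.w * (star S.w * S.ι' (ψ n i))) = 1 := by
  rw [← ht.sum_eq_one, Fintype.sum_sigma]
  exact Finset.sum_congr rfl fun n _ => S.sum_smul_eq_sum hθ ht hψ n

theorem E_eq_sum [Algebra.IsCentral ℂ M] {K : Type*} [Fintype K] {γs : K → (M →⋆ₐ[ℂ] M)} {s : K → M}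
    (hs : IsDirectSumHom S.γ γs s) (hγ : ∀ a, IsIrreducibleHom (γs a)) (a : K) :
    S.E (s a) = ∑ n, ∑ i, ((homDim (γs a) * homDim (θs n) / homDim S.ι ^ 2 : ℝ) : ℂ) •
      (S.jL (S.posMap (γs a) (s a) (star (ψ n i))) * S.jR (ψ n i)) := by
  have hpos := (S.homDim_pos_and_partial_trace hs hγ a).1
  have hd := S.sol.param_pos
  have he := S.proj_mem hs a
  have hterm : ∀ n i, ((homDim (γs a) * homDim (θs n) / homDim S.ι ^ 2 : ℝ) : ℂ) •
      (S.embL (S.posMap (γs a) (s a) (star (ψ n i))) * S.embR (ψ n i)) =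
      S.ι' (S.ι (star S.w) * (s a * star (s a)) *
        S.ι (((homDim (θs n) / homDim S.ι : ℝ) : ℂ) •
          (S.ι' (star (ψ n i)) * S.w * (star S.w * S.ι' (ψ n i)))) * S.ι S.x) := by
    intro n i
    have hmem := Intertwiners.star_mem (S.posMap_mem (hs.mem a) ((hψ n).mem i))
    rw [← posMap_star] at hmem
    rw [(S.embL_mul_embR_eq (S.embL_mul_embR_commute hmem ((hψ n).mem i))).2, ← map_smul,
      S.posMap_eq (hs.mem a) (div_nonneg hd.le hpos.le), ← he]
    congr 1
    rw [smul_mul_assoc, smul_smul, map_smul, mul_smul_comm, smul_mul_assoc, ← Complex.ofReal_mul]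
    congr 1
    · congr 1
      field_simp
    · change S.ι (star S.w) * (s a * star (s a) * S.ι (S.ι' (star (ψ n i)))) * S.ι S.w *
        S.ι (star S.w * S.ι' (ψ n i * S.v)) = _ * _ * S.ι (S.ι' S.v)
      simp only [map_mul, mul_assoc]
  refine Subtype.ext ?_
  rw [AddSubmonoidClass.coe_finsetSum]
  simp only [AddSubmonoidClass.coe_finsetSum]
  change (S.E (s a) : N) = ∑ n, ∑ i, ((homDim (γs a) * homDim (θs n) / homDim S.ι ^ 2 : ℝ) : ℂ) •
      ((S.jL (S.posMap (γs a) (s a) (star (ψ n i))) : N) * (S.jR (ψ n i) : N))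
  simp only [S.coe_jL, S.coe_jR, hterm]
  simp only [← map_sum, ← Finset.mul_sum, ← Finset.sum_mul]
  -- Completeness removes the inner sum; what is left, ι(w*)e_a ι(x), equals e_a by w*x = 1.
  rw [S.sum_sum_smul_eq_one hθ ht hψ, map_one, mul_one, S.coe_E he]
  have h1 : s a * star (s a) * S.ι S.x = S.ι S.x * (s a * star (s a)) := he S.v
  rw [mul_assoc, h1, ← mul_assoc, ← map_mul, star_w_mul_x, map_one, one_mul]

end Decomposition

end LocalExtension

end

theorem propositionp {N M : Type*} [CStarAlgebra N] [CStarAlgebra M]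
    [Nontrivial N] [Nontrivial M] [Algebra.IsCentral ℂ N] [Algebra.IsCentral ℂ M]
    (S : LocalExtension N M)
    -- the decomposition of `γ` into irreducibles `γ a`
    {K : Type*} [Fintype K] (γs : K → (M →⋆ₐ[ℂ] M)) (s : K → M)
    (hγ : ∀ a, IsIrreducibleHom (γs a))
    (hs : IsDirectSumHom S.γ γs s)
    -- the decomposition of `θ` into irreducibles `θs n` with multiplicities `m n`
    {J : Type*} [Fintype J] (m : J → ℕ) (θs : J → (N →⋆ₐ[ℂ] N))
    (t : (Σ n, Fin (m n)) → N)
    (hθ : ∀ n, IsIrreducibleHom (θs n))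
    (hθ_ne : ∀ n n', n ≠ n' → ¬ UnitarilyEquivalent (θs n) (θs n'))
    (ht : IsDirectSumHom S.θ (fun p : Σ n, Fin (m n) => θs p.1) t)
    -- orthonormal bases of the spaces `Hom(ι, ι θs n)`
    (ψ : ∀ n, Fin (m n) → M)
    (hψ : ∀ n, IsOrthonormalBasisOfIntertwiners S.ι (S.ι.comp (θs n)) (ψ n)) :
    -- `C_uni = ι_uni(N) V_uni`
    (∀ c : S.Cuni, ∃ n : N, c = S.ιuni n * S.Vuni) ∧
    -- `jᴸ` and `jᴿ` are embeddings with `jᴸ ι = ι_uni = jᴿ ι` and the given values at `v`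
    (∃ JL : M →⋆ₐ[ℂ] S.Cuni, (∀ y, JL y = S.jL y) ∧ Function.Injective JL ∧
      (∀ n, JL (S.ι n) = S.ιuni n) ∧ JL S.v = S.vL) ∧
    (∃ JR : M →⋆ₐ[ℂ] S.Cuni, (∀ y, JR y = S.jR y) ∧ Function.Injective JR ∧
      (∀ n, JR (S.ι n) = S.ιuni n) ∧ JR S.v = S.vR) ∧
    -- the `E a` are the distinct minimal central projections of `C_uni`
    Function.Injective (fun a => S.E (s a)) ∧
    (∀ p : S.Cuni, IsMinimalCentralProjection p ↔ ∃ a, p = S.E (s a)) ∧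
    -- the `E a` as weighted sums
    (∀ a, S.E (s a) = ∑ n, ∑ i,
      ((homDim (γs a) * homDim (θs n) / homDim S.ι ^ 2 : ℝ) : ℂ) •
        (S.jL (S.posMap (γs a) (s a) (star (ψ n i))) * S.jR (ψ n i))) ∧
    -- the matrices `U n a` of the positive maps in the bases `ψ n`
    (∃! U : ∀ n, K → Matrix (Fin (m n)) (Fin (m n)) ℂ,
      ∀ n a i, S.posMap (γs a) (s a) (ψ n i) = ∑ j, U n a j i • ψ n j) ∧
    ∀ U : ∀ n, K → Matrix (Fin (m n)) (Fin (m n)) ℂ,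
      (∀ n a i, S.posMap (γs a) (s a) (ψ n i) = ∑ j, U n a j i • ψ n j) →
      -- the products of the embedded charged fields in `C_uni`
      (∀ n i j, S.jL (star (ψ n j)) * S.jR (ψ n i) = ∑ a, U n a j i • S.E (s a)) ∧
      -- their values in the boundary condition `π a`
      (∀ (D : Type*) [Ring D] [StarRing D] [Algebra ℂ D] [StarModule ℂ D]
        (π : S.Cuni →⋆ₐ[ℂ] D) (a : K),
        π (S.E (s a)) = 1 → (∀ b, b ≠ a → π (S.E (s b)) = 0) →
        ∀ n i j, star (π (S.jL (ψ n j))) * π (S.jR (ψ n i)) = U n a j i • (1 : D)) := by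
  refine ⟨S.exists_eq_ιuni_mul_Vuni,
    ⟨S.homL, S.homL_apply, ?_, fun n => Subtype.ext (S.embL_ι n), Subtype.ext S.coe_vL.symm⟩,
    ⟨S.homR, S.homR_apply, ?_, fun n => Subtype.ext (S.embR_ι n), Subtype.ext S.coe_vR.symm⟩,
    S.E_injective hs, S.isMinimalCentralProjection_iff hs hγ, S.E_eq_sum hθ ht hψ hs hγ,
    S.existsUnique_matrix hs hψ, ?_⟩
  · exact fun a b hab => S.embL_injective (congrArg Subtype.val hab)
  · exact fun a b hab => S.embR_injective (congrArg Subtype.val hab)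
  intro U hU
  have hprod : ∀ n i j, S.jL (star (ψ n j)) * S.jR (ψ n i) = ∑ a, U n a j i • S.E (s a) :=
    fun n i j => S.jL_mul_jR_eq_sum hs hγ (hψ n) (hU n) i j
  refine ⟨hprod, ?_⟩
  intro D _ _ _ _ π a ha hb n i j
  -- The adjoint passes through π and jᴸ, and π annihilates every E_b except E_a.
  rw [← map_star, ← S.homL_apply, ← map_star, S.homL_apply, ← map_mul, hprod, map_sum,
    Finset.sum_eq_single a]
  · rw [map_smul, ha]
  · intro b _ hba
    rw [map_smul, hb b hba, smul_zero]
  · exact fun h => absurd (Finset.mem_univ a) h
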